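/- Let $m,k$ be integers with $1<k<m$, and assume that either $k>2$, or $k=2$ and $m\ge 6$. Let $M$ be a smooth manifold of dimension $\binom{m}{k}+m$, and let $\omega\in\Omega^{k+1}(M)$ be multisymplectic, i.e. smooth, closed, and non-degenerate in the sense that for every $p\in M$ the map $T_pM\to\Lambda^kT_p^*M$, $v\mapsto\iota_v\omega_p$, is injective. For $p\in M$ put $$I_m(\omega)_p:=\{v\in T_pM \mid \operatorname{rank}(\iota_v\omega_p)\le m\},$$ where the rank of an exterior form $\eta$ on a vector space $V$ is the rank of the linear map $u\mapsto\iota_u\eta$ on $V$. Assume that for every $p\in M$ the set $I_m(\omega)_p$ is a linear subspace of $T_pM$ of dimension $\binom{m}{k}$ and that $$\iota_w\iota_v\omega_p=0\qquad\text{for all } v,w\in I_m(\omega)_p .$$ Then $I_m(\omega)$ is a smooth distribution on $M$ of rank $\binom{m}{k}$ and it is involutive: for all smooth vector fields $X,Y$ on an open set $U\subset M$ with values in $I_m(\omega)$, the Lie bracket $[X,Y]$ again has values in $I_m(\omega)$. -/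

import Mathlib

open scoped Manifold ContDiff

noncomputable section

namespace Multisymplectic

/-! ### Exterior forms on a real vector space -/

section LinearAlgebra

variable {V : Type*} [AddCommGroup V] [Module ℝ V]

/-- The contraction `ι_v η` of an exterior form `η` with a vector `v` in the first slot,
as a linear map `v ↦ ι_v η`; it is zero on forms of degree `0`. -/
def contract : {j : ℕ} → (V [⋀^Fin j]→ₗ[ℝ] ℝ) → V →ₗ[ℝ] (V [⋀^Fin (j - 1)]→ₗ[ℝ] ℝ)
  | 0, _ => 0
  | _ + 1, η => η.curryLeft

/-- An exterior form `η` is non-degenerate if `v ↦ ι_v η` is injective. -/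
def Nondegenerate {j : ℕ} (η : V [⋀^Fin j]→ₗ[ℝ] ℝ) : Prop :=
  Function.Injective (contract η)

/-- The rank of an exterior form `η`: the rank of the linear map `v ↦ ι_v η`. -/
def formRank {j : ℕ} (η : V [⋀^Fin j]→ₗ[ℝ] ℝ) : ℕ :=
  Module.finrank ℝ (LinearMap.range (contract η))

/-- `I_r(η) = {v | rank (ι_v η) ≤ r}`. -/
def lowRankSet {j : ℕ} (r : ℕ) (η : V [⋀^Fin j]→ₗ[ℝ] ℝ) : Set V :=
  {v | formRank (contract η v) ≤ r}

end LinearAlgebra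

/-! ### Differential forms and distributions on a manifold modelled on `E` -/

section Manifold

variable {E : Type*} [NormedAddCommGroup E] [NormedSpace ℝ E]
  {M : Type*} [TopologicalSpace M] [ChartedSpace E M]

/-- The coordinate expression of a field `Ω` of `j`-forms in the preferred chart at `x₀`: the
pullback of `Ω` along the inverse of that chart (meaningful on the target of the chart). -/
def formInChart {j : ℕ} (Ω : ∀ x : M, TangentSpace 𝓘(ℝ, E) x [⋀^Fin j]→L[ℝ] ℝ) (x₀ : M) :
    E → E [⋀^Fin j]→L[ℝ] ℝ := fun y =>
  (Ω ((extChartAt 𝓘(ℝ, E) x₀).symm y)).compContinuousLinearMap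
    (mfderiv 𝓘(ℝ, E) 𝓘(ℝ, E) (extChartAt 𝓘(ℝ, E) x₀).symm y)

/-- `Ω` is a smooth differential form: its coordinate expressions are smooth in charts
covering the manifold. -/
def IsSmoothForm {j : ℕ} (Ω : ∀ x : M, TangentSpace 𝓘(ℝ, E) x [⋀^Fin j]→L[ℝ] ℝ) : Prop :=
  ∀ x₀ : M, ContDiffOn ℝ ∞ (formInChart Ω x₀) (extChartAt 𝓘(ℝ, E) x₀).target

/-- `dΩ = 0`: the exterior derivatives of the coordinate expressions of `Ω` vanish, in charts
covering the manifold. -/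
def IsClosedForm {j : ℕ} (Ω : ∀ x : M, TangentSpace 𝓘(ℝ, E) x [⋀^Fin j]→L[ℝ] ℝ) : Prop :=
  ∀ x₀ : M, ∀ y ∈ (extChartAt 𝓘(ℝ, E) x₀).target, extDeriv (formInChart Ω x₀) y = 0

/-- The exterior form `Ω_p` on the tangent space at `p`. -/
def formAt {j : ℕ} (Ω : ∀ x : M, TangentSpace 𝓘(ℝ, E) x [⋀^Fin j]→L[ℝ] ℝ) (p : M) :
    TangentSpace 𝓘(ℝ, E) p [⋀^Fin j]→ₗ[ℝ] ℝ :=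
  (Ω p).toAlternatingMap

/-- A multisymplectic form: a smooth, closed differential form, non-degenerate at every point. -/
structure IsMultisymplectic {j : ℕ}
    (Ω : ∀ x : M, TangentSpace 𝓘(ℝ, E) x [⋀^Fin j]→L[ℝ] ℝ) : Prop where
  smooth : IsSmoothForm Ω
  closed : IsClosedForm Ω
  nondegenerate : ∀ p : M, Nondegenerate (formAt Ω p)

variable [IsManifold 𝓘(ℝ, E) ∞ M]

/-- The vector field `X` is smooth on `U`. -/
def IsSmoothVectorFieldOn (X : ∀ x : M, TangentSpace 𝓘(ℝ, E) x) (U : Set M) : Prop :=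
  ContMDiffOn 𝓘(ℝ, E) 𝓘(ℝ, E).tangent ∞
    (fun x => (⟨x, X x⟩ : TangentBundle 𝓘(ℝ, E) M)) U

/-- A family `D` of subsets of the tangent spaces is a (smooth, regular) distribution of rank `r`:
near every point there are `r` smooth vector fields that form, at every point, a basis of `D`. -/
def IsDistribution (r : ℕ) (D : ∀ x : M, Set (TangentSpace 𝓘(ℝ, E) x)) : Prop :=
  ∀ p : M, ∃ U : Set M, IsOpen U ∧ p ∈ U ∧
    ∃ X : Fin r → ∀ x : M, TangentSpace 𝓘(ℝ, E) x,
      (∀ i, IsSmoothVectorFieldOn (X i) U) ∧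
      ∀ q ∈ U, LinearIndependent ℝ (fun i => X i q) ∧
        D q = (Submodule.span ℝ (Set.range fun i => X i q) : Set (TangentSpace 𝓘(ℝ, E) q))

/-- `D` is involutive: the Lie bracket of two smooth local sections of `D` is a section of `D`. -/
def IsInvolutive (D : ∀ x : M, Set (TangentSpace 𝓘(ℝ, E) x)) : Prop :=
  ∀ U : Set M, IsOpen U → ∀ X Y : ∀ x : M, TangentSpace 𝓘(ℝ, E) x,
    IsSmoothVectorFieldOn X U → IsSmoothVectorFieldOn Y U →
    (∀ q ∈ U, X q ∈ D q) → (∀ q ∈ U, Y q ∈ D q) →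
    ∀ q ∈ U, VectorField.mlieBracket 𝓘(ℝ, E) X Y q ∈ D q

end Manifold

end Multisymplectic

end

noncomputable section

/-! Write `k = n + 1`. At one point, put `W = I_m(ω)_p` and choose a complement `C`, of dimension
`m`. Isotropy makes `η(w, ·)`, for `w ∈ W`, depend on its arguments modulo `W` only, so by
non-degeneracy and a dimension count contraction identifies `W` with the `k`-forms on `C`
(`IsVertical.exists_equiv`). Both conclusions thereby reduce to algebra on `Λᵏ C*`: a linear `B : Λᵏ
C* → C` with `β(Bα, ·) = α(Bβ, ·)` is zero (`eq_zero_of_symm`), and an antisymmetric bilinear `c`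
with `γ(c(α, β), ·) + cyclic = 0` is zero (`eq_zero_of_cyclic`). The exceptional range `k = 2`, `m <
6` is excluded by the second statement alone.

Smoothness: in a chart, let `Pr y` be the projection onto the fibre at `y` along a fixed `C`. Lower
semicontinuity of rank and constancy of dimension make `Pr` continuous. Isotropy is an algebraic
equation on `Pr y`, whose linearization is the symmetric pairing above; it has no nonzero solution,
so the implicit function theorem makes `Pr` smooth (`contDiffAt_projection`).

Involutivity: modulo the distribution, the bracket of two sections is `c(x, y) = (D_x Pr) y - (D_y
Pr) x`. Differentiating isotropy and inserting the result in `dω = 0` gives the cyclic identity for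
`c`, so `c` maps `W × W` into `W` (`bracket_projection_mem`). -/

namespace Multisymplectic

open scoped Topology
open Filter

/-! ### Dual-basis forms and the two vanishing statements on `Λᵏ C*` -/

section CoordinateForms

variable {C : Type*} [AddCommGroup C] [Module ℝ C] {ι : Type*} [Fintype ι] [DecidableEq ι]

/-- The exterior product `e^{s 0} ∧ ⋯ ∧ e^{s (k-1)}` of elements of the dual basis. -/
def coordForm (b : Module.Basis ι ℝ C) {k : ℕ} (s : Fin k → ι) : C [⋀^Fin k]→ₗ[ℝ] ℝ :=
  MultilinearMap.alternatization
    ((MultilinearMap.mkPiAlgebra ℝ (Fin k) ℝ).compLinearMap fun i => b.coord (s i))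

lemma coordForm_apply_basis (b : Module.Basis ι ℝ C) {k : ℕ} (s t : Fin k → ι) :
    coordForm b s (fun i => b (t i)) =
      ∑ σ : Equiv.Perm (Fin k), Equiv.Perm.sign σ • ∏ i, if t (σ i) = s i then (1 : ℝ) else 0 := by
  simp [coordForm, MultilinearMap.alternatization_apply, Finsupp.single_apply]

lemma coordForm_apply_basis_eq_zero (b : Module.Basis ι ℝ C) {k : ℕ} (s t : Fin k → ι)
    (j : Fin k) (hj : t j ∉ Set.range s) : coordForm b s (fun i => b (t i)) = 0 := by
  rw [coordForm_apply_basis]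
  refine Finset.sum_eq_zero fun σ _ => ?_
  rw [Finset.prod_eq_zero (Finset.mem_univ (σ⁻¹ j)), smul_zero]
  rw [if_neg]
  intro h
  exact hj ⟨σ⁻¹ j, by simpa using h.symm⟩

lemma coordForm_apply_self (b : Module.Basis ι ℝ C) {k : ℕ} (s : Fin k → ι)
    (hs : Function.Injective s) : coordForm b s (fun i => b (s i)) = 1 := by
  rw [coordForm_apply_basis, Finset.sum_eq_single 1]
  · simp
  · intro σ _ hσ
    obtain ⟨i, hi⟩ : ∃ i, σ i ≠ i := by
      by_contra! h
      exact hσ (Equiv.ext h)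
    rw [Finset.prod_eq_zero (Finset.mem_univ i), smul_zero]
    rw [if_neg fun h => hi (hs h)]
  · simp

/-- If an injective tuple `t` took all its values in the range of `s`, it would be `s ∘ f` with `f`
injective on `Fin k`, hence bijective, and `s` would be injective. So some `t j` always escapes the
range of `s`. -/
lemma coordForm_eq_zero (b : Module.Basis ι ℝ C) {k : ℕ} (s : Fin k → ι)
    (hs : ¬ Function.Injective s) : coordForm b s = 0 := by
  refine Module.Basis.ext_alternating b fun t ht => ?_
  obtain ⟨j, hj⟩ : ∃ j, t j ∉ Set.range s := by
    by_contra! h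
    choose f hf using h
    have hfi : Function.Injective f := fun x y hxy => ht (by rw [← hf x, ← hf y, hxy])
    have hfs := Finite.surjective_of_injective hfi
    refine hs fun x y hxy => ?_
    obtain ⟨x', rfl⟩ := hfs x
    obtain ⟨y', rfl⟩ := hfs y
    rw [hf, hf] at hxy
    rw [ht hxy]
  rw [coordForm_apply_basis_eq_zero b s t j hj]; rfl

lemma multilinear_eq_sum_basis (b : Module.Basis ι ℝ C) {k : ℕ}
    (μ : MultilinearMap ℝ (fun _ : Fin k => C) ℝ) :
    μ = ∑ s : Fin k → ι,
      μ (fun i => b (s i)) • (MultilinearMap.mkPiAlgebra ℝ (Fin k) ℝ).compLinearMap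
        (fun i => b.coord (s i)) := by
  refine Module.Basis.ext_multilinear (fun _ => b) fun t => ?_
  rw [sum_apply, Finset.sum_eq_single t]
  · simp
  · intro s _ hst
    obtain ⟨i, hi⟩ := Function.ne_iff.1 hst
    simp only [smul_apply, MultilinearMap.compLinearMap_apply,
      MultilinearMap.mkPiAlgebra_apply]
    rw [Finset.prod_eq_zero (Finset.mem_univ i), smul_zero]
    simp [hi.symm]
  · simp

/-- Alternatize the multilinear basis expansion: on a form that is already alternating this
multiplies by `k!`. Summing over all tuples avoids choosing ordered index sets. -/
lemma factorial_smul_eq_sum_coordForm (b : Module.Basis ι ℝ C) {k : ℕ}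
    (α : C [⋀^Fin k]→ₗ[ℝ] ℝ) :
    k.factorial • α = ∑ s : Fin k → ι, α (fun i => b (s i)) • coordForm b s := by
  have h := multilinear_eq_sum_basis b (α : MultilinearMap ℝ (fun _ : Fin k => C) ℝ)
  have h2 := AlternatingMap.coe_alternatization α
  rw [Fintype.card_fin] at h2
  rw [← h2, h, map_sum]
  refine Finset.sum_congr rfl fun s _ => ?_
  ext v
  simp [coordForm, MultilinearMap.alternatization_apply, Finset.mul_sum, mul_left_comm,
    Units.smul_def]

/-- A linear map on forms is determined by its values on the forms of a dual basis. -/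
lemma linearMap_eq_zero_of_coordForm (b : Module.Basis ι ℝ C) {k : ℕ} {N : Type*}
    [AddCommGroup N] [Module ℝ N] (φ : (C [⋀^Fin k]→ₗ[ℝ] ℝ) →ₗ[ℝ] N)
    (h : ∀ s : Fin k → ι, Function.Injective s → φ (coordForm b s) = 0) : φ = 0 := by
  ext α
  have h1 := congrArg φ (factorial_smul_eq_sum_coordForm b α)
  rw [map_nsmul, map_sum, Finset.sum_eq_zero] at h1
  · rw [← Nat.cast_smul_eq_nsmul ℝ] at h1
    simpa [Nat.factorial_ne_zero] using h1
  · intro s _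
    by_cases hs : Function.Injective s
    · simp [h s hs]
    · simp [coordForm_eq_zero b s hs]

lemma finrank_alternatingMap [FiniteDimensional ℝ C] (k : ℕ) :
    Module.finrank ℝ (C [⋀^Fin k]→ₗ[ℝ] ℝ) = (Module.finrank ℝ C).choose k := by
  rw [(exteriorPower.alternatingMapLinearEquiv (R := ℝ) (M := C) (N := ℝ) (n := k)).finrank_eq,
    ← exteriorPower.finrank_eq (R := ℝ) (M := C)]
  exact Subspace.dual_finrank_eq

/-- The linear functional `v ↦ β(v, u)`. -/
def headMap {n : ℕ} (β : C [⋀^Fin (n + 1)]→ₗ[ℝ] ℝ) (u : Fin n → C) : C →ₗ[ℝ] ℝ where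
  toFun v := β (Matrix.vecCons v u)
  map_add' x y := β.map_vecCons_add u x y
  map_smul' r x := β.map_vecCons_smul u r x

/-- If only one basis vector pairs nontrivially, the value on `v` is read off its coordinate. -/
lemma map_vecCons_eq_coord_mul (b : Module.Basis ι ℝ C) {n : ℕ} (β : C [⋀^Fin (n + 1)]→ₗ[ℝ] ℝ)
    (u : Fin n → C) (a : ι) (h : ∀ j, j ≠ a → β (Matrix.vecCons (b j) u) = 0) (v : C) :
    β (Matrix.vecCons v u) = b.coord a v * β (Matrix.vecCons (b a) u) := by
  change headMap β u v = _
  conv_lhs => rw [← b.sum_repr v, map_sum]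
  rw [Finset.sum_eq_single a]
  · rw [map_smul]; rfl
  · intro j _ hj
    rw [map_smul]
    exact (congrArg _ (h j hj)).trans (smul_zero _)
  · simp

/-- Every finite set is the range of an injective enumeration. -/
lemma exists_enumeration (T : Finset ι) {n : ℕ} (hT : T.card = n) :
    ∃ t : Fin n → ι, Function.Injective t ∧ ∀ i, i ∈ Set.range t ↔ i ∈ T := by
  refine ⟨fun i => ((T.equivFinOfCardEq hT).symm i : ι), ?_, fun i => ⟨?_, fun hi => ?_⟩⟩
  · exact Subtype.val_injective.comp (Equiv.injective _)
  · rintro ⟨j, rfl⟩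
    exact Subtype.property _
  · exact ⟨T.equivFinOfCardEq hT ⟨i, hi⟩, by simp⟩

lemma basis_vecCons (b : Module.Basis ι ℝ C) {n : ℕ} (a : ι) (t : Fin n → ι) :
    Matrix.vecCons (b a) (fun i => b (t i)) = fun i => b (Matrix.vecCons a t i) := by
  funext i
  refine Fin.cases ?_ (fun i => ?_) i <;> simp

lemma injective_vecCons {n : ℕ} {a : ι} {t : Fin n → ι} (ht : Function.Injective t)
    (ha : a ∉ Set.range t) : Function.Injective (Matrix.vecCons a t) :=
  Fin.cons_injective_iff.2 ⟨ha, ht⟩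

lemma range_vecCons {n : ℕ} (a : ι) (t : Fin n → ι) :
    Set.range (Matrix.vecCons a t) = insert a (Set.range t) :=
  Fin.range_cons a t

/-- The probe used below: `e^a ∧ e^t`, evaluated with the last slots filled by `b ∘ t`, isolates the
`a`-coordinate. The next lemma says which other forms the same slots annihilate. -/
lemma coordForm_vecCons (b : Module.Basis ι ℝ C) {n : ℕ} (a : ι) (t : Fin n → ι)
    (ht : Function.Injective t) (ha : a ∉ Set.range t) (v : C) :
    coordForm b (Matrix.vecCons a t) (Matrix.vecCons v fun i => b (t i)) = b.coord a v := by
  rw [map_vecCons_eq_coord_mul b _ _ a, basis_vecCons,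
    coordForm_apply_self _ _ (injective_vecCons ht ha), mul_one]
  intro j hj
  by_cases hjt : j ∈ Set.range t
  · obtain ⟨i, rfl⟩ := hjt
    exact AlternatingMap.map_eq_zero_of_eq _ _ (i := 0) (j := i.succ) (by simp)
      (Fin.succ_ne_zero i).symm
  · rw [basis_vecCons]
    refine coordForm_apply_basis_eq_zero b _ _ 0 ?_
    rw [range_vecCons]
    simp only [Matrix.cons_val_zero, Set.mem_insert_iff, not_or]
    exact ⟨hj, hjt⟩

lemma coordForm_vecCons_eq_zero (b : Module.Basis ι ℝ C) {n : ℕ} (s : Fin (n + 1) → ι)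
    (t : Fin n → ι) {i : ι} (hi : i ∈ Set.range t) (his : i ∉ Set.range s) (v : C) :
    coordForm b s (Matrix.vecCons v fun i => b (t i)) = 0 := by
  obtain ⟨j, rfl⟩ := hi
  change headMap (coordForm b s) (fun i => b (t i)) v = 0
  rw [← b.sum_repr v, map_sum]
  refine Finset.sum_eq_zero fun a _ => ?_
  rw [map_smul]
  refine (congrArg _ ?_).trans (smul_zero _)
  change coordForm b s _ = 0
  rw [basis_vecCons, coordForm_apply_basis_eq_zero b s _ j.succ (by simpa using his)]

lemma exists_notMem_range {n : ℕ} (s : Fin n → ι) (a : ι) (h : n + 2 ≤ Fintype.card ι) :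
    ∃ i, i ∉ Set.range s ∧ i ≠ a := by
  by_contra! h'
  have h1 : (Finset.univ : Finset ι) ⊆ insert a (Finset.univ.image s) := by
    intro i _
    by_cases hi : i ∈ Set.range s
    · simpa using Or.inr hi
    · simp [h' i hi]
  have h2 := (Finset.card_le_card h1).trans (Finset.card_insert_le _ _)
  have h3 := Finset.card_image_le (s := (Finset.univ : Finset (Fin n))) (f := s)
  simp only [Finset.card_univ, Fintype.card_fin] at h2 h3
  omega

lemma exists_notMem_range_two {n k : ℕ} (s : Fin n → ι) (r : Fin k → ι) (a : ι)
    (h : n + k + 2 ≤ Fintype.card ι) :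
    ∃ i, i ∉ Set.range s ∧ i ∉ Set.range r ∧ i ≠ a := by
  obtain ⟨i, hi, hia⟩ := exists_notMem_range (Fin.append s r) a h
  refine ⟨i, ?_, ?_, hia⟩
  · rintro ⟨j, rfl⟩
    exact hi ⟨Fin.castAdd k j, by simp⟩
  · rintro ⟨j, rfl⟩
    exact hi ⟨Fin.natAdd n j, by simp⟩

/-- A symmetric pairing `β(Bα, ·) = α(Bβ, ·)` on forms forces `B = 0`, below degree `dim C - 1`. -/
lemma eq_zero_of_symm_of_card (b : Module.Basis ι ℝ C) {n : ℕ} (hn : 1 ≤ n)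
    (hι : n + 3 ≤ Fintype.card ι) (B : (C [⋀^Fin (n + 1)]→ₗ[ℝ] ℝ) →ₗ[ℝ] C)
    (hB : ∀ (α β : C [⋀^Fin (n + 1)]→ₗ[ℝ] ℝ) (u : Fin n → C), β (Matrix.vecCons (B α) u) =
      α (Matrix.vecCons (B β) u)) : B = 0 := by
  refine linearMap_eq_zero_of_coordForm b B fun s hs => b.ext_elem fun a => ?_
  -- An index `i` in `t` but outside `s` kills the right-hand side of the symmetry, while `β = e^a ∧
  -- e^t` turns the left-hand side into the `a`-coordinate of `B (e^s)`.
  obtain ⟨i, his, hia⟩ := exists_notMem_range s a hι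
  obtain ⟨T, hiT, hTa, hT⟩ := Finset.exists_subsuperset_card_eq
    (s := {i}) (t := {a}ᶜ) (n := n) (by simpa using Ne.symm hia) (by simpa using hn)
    (by rw [Finset.card_compl, Finset.card_singleton]; omega)
  obtain ⟨t, ht, htT⟩ := exists_enumeration T hT
  have ha : a ∉ Set.range t := fun h => by simpa using hTa ((htT a).1 h)
  have hi : i ∈ Set.range t := (htT i).2 (hiT (by simp))
  have h1 := hB (coordForm b s) (coordForm b (Matrix.vecCons a t)) fun i => b (t i)
  rw [coordForm_vecCons b a t ht ha, coordForm_vecCons_eq_zero b s t hi his] at h1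
  simpa using h1

/-- A bilinear map `c` on forms with `γ(c(α, β), ·) + cyclic = 0` vanishes, below degree
`dim C - 1`. -/
lemma eq_zero_of_cyclic_of_card (b : Module.Basis ι ℝ C) {n : ℕ}
    (hι : (2 ≤ n ∧ n + 3 ≤ Fintype.card ι) ∨ (n = 1 ∧ 6 ≤ Fintype.card ι))
    (c : (C [⋀^Fin (n + 1)]→ₗ[ℝ] ℝ) →ₗ[ℝ] (C [⋀^Fin (n + 1)]→ₗ[ℝ] ℝ) →ₗ[ℝ] C)
    (hc : ∀ (α β γ : C [⋀^Fin (n + 1)]→ₗ[ℝ] ℝ) (u : Fin n → C),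
      γ (Matrix.vecCons (c α β) u) + α (Matrix.vecCons (c β γ) u) +
      β (Matrix.vecCons (c γ α) u) = 0) : c = 0 := by
  refine linearMap_eq_zero_of_coordForm b c fun s hs =>
    linearMap_eq_zero_of_coordForm b (c _) fun r hr => b.ext_elem fun a => ?_
  -- With `γ = e^a ∧ e^t`, the two unwanted terms die once `t` contains an index outside `s` and one
  -- outside `r`. Two such indices fit when `n ≥ 2`; for `n = 1` a single index must avoid `s`, `r`
  -- and `a`, up to five values, whence the bound `6`.
  obtain ⟨S, hSn, hSa, i, hiS, his, j, hjS, hjr⟩ : ∃ S : Finset ι, S.card ≤ n ∧ S ⊆ {a}ᶜ ∧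
      ∃ i ∈ S, i ∉ Set.range s ∧ ∃ j ∈ S, j ∉ Set.range r := by
    rcases hι with ⟨hn, hι⟩ | ⟨rfl, hι⟩
    · obtain ⟨i, his, hia⟩ := exists_notMem_range s a hι
      obtain ⟨j, hjr, hja⟩ := exists_notMem_range r a hι
      refine ⟨{i, j}, Finset.card_le_two.trans hn, ?_, i, by simp, his, j, by simp, hjr⟩
      intro x hx
      simp only [Finset.mem_insert, Finset.mem_singleton] at hx
      rcases hx with rfl | rfl <;> simpa
    · obtain ⟨i, his, hir, hia⟩ := exists_notMem_range_two s r a hι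
      exact ⟨{i}, by simp, by simpa using Ne.symm hia, i, by simp, his, i, by simp, hir⟩
  obtain ⟨T, hST, hTa, hT⟩ := Finset.exists_subsuperset_card_eq hSa hSn
    (by rw [Finset.card_compl, Finset.card_singleton]; omega)
  obtain ⟨t, ht, htT⟩ := exists_enumeration T hT
  have ha : a ∉ Set.range t := fun h => by simpa using hTa ((htT a).1 h)
  have h1 := hc (coordForm b s) (coordForm b r) (coordForm b (Matrix.vecCons a t)) fun i => b (t i)
  rw [coordForm_vecCons b a t ht ha, coordForm_vecCons_eq_zero b s t ((htT i).2 (hST hiS)) his,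
    coordForm_vecCons_eq_zero b r t ((htT j).2 (hST hjS)) hjr] at h1
  simpa using h1

/-! #### Codegree one: forms `ν(x, ·)` for a volume form `ν` -/

lemma map_vecCons_vecCons_swap {n : ℕ} (η : C [⋀^Fin (n + 2)]→ₗ[ℝ] ℝ) (x y : C) (u : Fin n → C) :
    η (Matrix.vecCons x (Matrix.vecCons y u)) = -η (Matrix.vecCons y (Matrix.vecCons x u)) := by
  have h : ∀ z, η (Matrix.vecCons z (Matrix.vecCons z u)) = 0 := fun z =>
    AlternatingMap.map_eq_zero_of_eq η _ (i := 0) (j := 1) (by simp) (by simp)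
  have e : ∀ x y z, η (Matrix.vecCons z (Matrix.vecCons (x + y) u)) =
      η (Matrix.vecCons z (Matrix.vecCons x u)) + η (Matrix.vecCons z (Matrix.vecCons y u)) :=
    fun x y z => (η.curryLeft z).map_vecCons_add u x y
  have h2 := h (x + y)
  rw [η.map_vecCons_add, e, e, h, h] at h2
  linear_combination h2

/-- Two full enumerations of the index set differ by a permutation, so the value is a sign. -/
lemma volume_apply_ne_zero (b : Module.Basis ι ℝ C) {k : ℕ} (hι : Fintype.card ι = k)
    (s : Fin k → ι) (hs : Function.Injective s) (t : Fin k → ι) (ht : Function.Injective t) :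
    coordForm b s (fun i => b (t i)) ≠ 0 := by
  have hc : Fintype.card (Fin k) = Fintype.card ι := by simp [hι]
  let e := Equiv.ofBijective s ((Fintype.bijective_iff_injective_and_card s).2 ⟨hs, hc⟩)
  let f := Equiv.ofBijective t ((Fintype.bijective_iff_injective_and_card t).2 ⟨ht, hc⟩)
  have h := (coordForm b s).map_perm (fun i => b (s i)) (f.trans e.symm)
  have h' : (fun i => b (s i)) ∘ (f.trans e.symm) = fun i => b (t i) := by
    funext i
    have : s (e.symm (f i)) = t i := e.apply_symm_apply (f i)
    simp [this]
  rw [h', coordForm_apply_self b s hs] at h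
  rw [h]
  intro h0
  rcases Int.units_eq_one_or (Equiv.Perm.sign (f.trans e.symm)) with h1 | h1 <;>
    simp [h1] at h0

lemma exists_compl_pair {n : ℕ} (hι : Fintype.card ι = n + 2) {a d : ι} (had : a ≠ d) :
    ∃ t : Fin n → ι, Function.Injective t ∧ ∀ i, i ∈ Set.range t ↔ i ≠ a ∧ i ≠ d := by
  obtain ⟨t, ht, h⟩ := exists_enumeration (({a, d} : Finset ι)ᶜ) (n := n)
    (by rw [Finset.card_compl, Finset.card_pair had]; omega)
  exact ⟨t, ht, fun i => by rw [h]; simp⟩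

lemma volume_vecCons_vecCons (b : Module.Basis ι ℝ C) {n : ℕ} (ν : C [⋀^Fin (n + 2)]→ₗ[ℝ] ℝ)
    {a d : ι} {t : Fin n → ι} (h : ∀ i, i ∈ Set.range t ↔ i ≠ a ∧ i ≠ d) (v : C) :
    ν (Matrix.vecCons (b d) (Matrix.vecCons v fun i => b (t i))) =
      b.coord a v * ν (Matrix.vecCons (b d) (Matrix.vecCons (b a) fun i => b (t i))) := by
  refine map_vecCons_eq_coord_mul b (ν.curryLeft (b d)) _ a (fun j hja => ?_) v
  by_cases hjd : j = d
  · subst hjd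
    exact AlternatingMap.map_eq_zero_of_eq ν _ (i := 0) (j := 1) (by simp) (by simp)
  · obtain ⟨i, hi⟩ := (h j).2 ⟨hja, hjd⟩
    exact AlternatingMap.map_eq_zero_of_eq (ν.curryLeft (b d)) _ (i := 0) (j := i.succ)
      (by simp [hi]) (Fin.succ_ne_zero i).symm

lemma volume_vecCons_vecCons_eq_zero (b : Module.Basis ι ℝ C) {n : ℕ}
    (ν : C [⋀^Fin (n + 2)]→ₗ[ℝ] ℝ) {t : Fin n → ι} {j : ι} (hj : j ∈ Set.range t) (v : C) :
    ν (Matrix.vecCons (b j) (Matrix.vecCons v fun i => b (t i))) = 0 := by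
  obtain ⟨i, rfl⟩ := hj
  exact AlternatingMap.map_eq_zero_of_eq ν _ (i := 0) (j := i.succ.succ)
      (by simp) (Fin.succ_ne_zero _).symm

lemma volume_basis_ne_zero (b : Module.Basis ι ℝ C) {n : ℕ} (ν : C [⋀^Fin (n + 2)]→ₗ[ℝ] ℝ)
    (hν : ∀ t : Fin (n + 2) → ι, Function.Injective t → ν (fun i => b (t i)) ≠ 0)
    {a d : ι} (had : a ≠ d) {t : Fin n → ι} (ht : Function.Injective t)
    (h : ∀ i, i ∈ Set.range t ↔ i ≠ a ∧ i ≠ d) :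
    ν (Matrix.vecCons (b d) (Matrix.vecCons (b a) fun i => b (t i))) ≠ 0 := by
  rw [basis_vecCons, basis_vecCons]
  refine hν _ (injective_vecCons (injective_vecCons ht ?_) ?_)
  · rw [h]; simp
  · rw [range_vecCons, Set.mem_insert_iff, h]
    simp [had.symm]

lemma exists_ne_list (l : List ι) (h : l.length < Fintype.card ι) : ∃ d, d ∉ l := by
  by_contra! h'
  have h1 : (Finset.univ : Finset ι) ⊆ l.toFinset := fun i _ => by simpa using h' i
  have h2 := (Finset.card_le_card h1).trans (List.toFinset_card_le l)
  rw [Finset.card_univ] at h2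
  omega

/-- In codegree one there is no spare index for the probe argument. Filling the slots with the
complement of a pair still isolates off-diagonal matrix entries of `B`; diagonal entries come out
pairwise opposite, and three pairwise opposite numbers vanish. Three indices exist because `n ≥ 1`.
-/
lemma volume_eq_zero_of_symm (b : Module.Basis ι ℝ C) {n : ℕ} (hn : 1 ≤ n)
    (hι : Fintype.card ι = n + 2) (ν : C [⋀^Fin (n + 2)]→ₗ[ℝ] ℝ)
    (hν : ∀ t : Fin (n + 2) → ι, Function.Injective t → ν (fun i => b (t i)) ≠ 0)
    (B : C →ₗ[ℝ] C)
    (hB : ∀ x y u, ν (Matrix.vecCons y (Matrix.vecCons (B x) u)) =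
      ν (Matrix.vecCons x (Matrix.vecCons (B y) u))) : B = 0 := by
  have hdiag : ∀ a d, a ≠ d → b.coord a (B (b a)) = -b.coord d (B (b d)) := by
    intro a d had
    obtain ⟨t, ht, h⟩ := exists_compl_pair hι had
    have h1 := hB (b a) (b d) fun i => b (t i)
    rw [volume_vecCons_vecCons b ν h, volume_vecCons_vecCons b ν (fun i => (h i).trans and_comm),
      map_vecCons_vecCons_swap ν (b a)] at h1
    have h2 := volume_basis_ne_zero b ν hν had ht h
    refine mul_right_cancel₀ h2 ?_
    linear_combination h1
  refine b.ext fun a => b.ext_elem fun e => ?_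
  suffices b.coord e (B (b a)) = 0 by simpa using this
  by_cases hea : e = a
  · subst hea
    obtain ⟨d, hd⟩ := exists_ne_list [e] (by simp; omega)
    obtain ⟨f, hf⟩ := exists_ne_list [e, d] (by simp; omega)
    simp only [List.mem_cons, List.not_mem_nil, or_false, not_or] at hd hf
    have h1 := hdiag e d (Ne.symm hd)
    have h2 := hdiag e f (Ne.symm hf.1)
    have h3 := hdiag d f (Ne.symm hf.2)
    linarith
  · obtain ⟨d, hd⟩ := exists_ne_list [e, a] (by simp; omega)
    simp only [List.mem_cons, List.not_mem_nil, or_false, not_or] at hd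
    obtain ⟨t, ht, h⟩ := exists_compl_pair hι (Ne.symm hd.1)
    have h1 := hB (b a) (b d) fun i => b (t i)
    rw [volume_vecCons_vecCons b ν h, volume_vecCons_vecCons_eq_zero b ν
      ((h a).2 ⟨Ne.symm hea, Ne.symm hd.2⟩)] at h1
    exact (mul_eq_zero.1 h1).resolve_right (volume_basis_ne_zero b ν hν (Ne.symm hd.1) ht h)

/-- For fixed `f`, the map `c(·, b f)` is treated like `B` above: the entries on its diagonal are
pairwise opposite over indices other than `f`. Three of these besides `f` require four indices, that
is `n ≥ 2`. -/
lemma volume_eq_zero_of_cyclic (b : Module.Basis ι ℝ C) {n : ℕ} (hn : 2 ≤ n)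
    (hι : Fintype.card ι = n + 2) (ν : C [⋀^Fin (n + 2)]→ₗ[ℝ] ℝ)
    (hν : ∀ t : Fin (n + 2) → ι, Function.Injective t → ν (fun i => b (t i)) ≠ 0)
    (c : C →ₗ[ℝ] C →ₗ[ℝ] C) (hanti : ∀ x y, c x y = -c y x)
    (hc : ∀ x y z u, ν (Matrix.vecCons z (Matrix.vecCons (c x y) u)) +
      ν (Matrix.vecCons x (Matrix.vecCons (c y z) u)) +
      ν (Matrix.vecCons y (Matrix.vecCons (c z x) u)) = 0) : c = 0 := by
  have hoff : ∀ e a f, e ≠ a → e ≠ f → b.coord e (c (b a) (b f)) = 0 := by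
    intro e a f hea hef
    obtain ⟨d, hd⟩ := exists_ne_list [e, a, f] (by simp; omega)
    simp only [List.mem_cons, List.not_mem_nil, or_false, not_or] at hd
    obtain ⟨t, ht, h⟩ := exists_compl_pair hι (Ne.symm hd.1)
    have h1 := hc (b a) (b f) (b d) fun i => b (t i)
    rw [volume_vecCons_vecCons b ν h, volume_vecCons_vecCons_eq_zero b ν
      ((h a).2 ⟨Ne.symm hea, Ne.symm hd.2.1⟩), volume_vecCons_vecCons_eq_zero b ν
      ((h f).2 ⟨Ne.symm hef, Ne.symm hd.2.2⟩), add_zero, add_zero] at h1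
    exact (mul_eq_zero.1 h1).resolve_right (volume_basis_ne_zero b ν hν (Ne.symm hd.1) ht h)
  have hdiag : ∀ a f d, a ≠ f → a ≠ d → f ≠ d →
      b.coord a (c (b a) (b f)) = -b.coord d (c (b d) (b f)) := by
    intro a f d haf had hfd
    obtain ⟨t, ht, h⟩ := exists_compl_pair hι had
    have h1 := hc (b a) (b f) (b d) fun i => b (t i)
    rw [volume_vecCons_vecCons b ν h, volume_vecCons_vecCons b ν (fun i => (h i).trans and_comm),
      map_vecCons_vecCons_swap ν (b a), volume_vecCons_vecCons_eq_zero b ν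
      ((h f).2 ⟨Ne.symm haf, hfd⟩), hanti (b f) (b d), map_neg] at h1
    refine mul_right_cancel₀ (volume_basis_ne_zero b ν hν had ht h) ?_
    linear_combination h1
  have hzero : ∀ a f, a ≠ f → b.coord a (c (b a) (b f)) = 0 := by
    intro a f haf
    obtain ⟨d, hd⟩ := exists_ne_list [a, f] (by simp; omega)
    obtain ⟨e, he⟩ := exists_ne_list [a, f, d] (by simp; omega)
    simp only [List.mem_cons, List.not_mem_nil, or_false, not_or] at hd he
    have h1 := hdiag a f d haf (Ne.symm hd.1) (Ne.symm hd.2)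
    have h2 := hdiag a f e haf (Ne.symm he.1) (Ne.symm he.2.1)
    have h3 := hdiag d f e hd.2 (Ne.symm he.2.2) (Ne.symm he.2.1)
    linarith
  refine b.ext fun a => b.ext fun f => b.ext_elem fun e => ?_
  suffices b.coord e (c (b a) (b f)) = 0 by simpa using this
  by_cases haf : a = f
  · subst haf
    have h0 : c (b a) (b a) = 0 := by
      have h := hanti (b a) (b a)
      rw [eq_neg_iff_add_eq_zero, ← two_smul ℝ] at h
      simpa using h
    rw [h0, map_zero]
  by_cases hea : e = a
  · subst hea
    exact hzero e f haf
  by_cases hef : e = f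
  · subst hef
    rw [hanti, map_neg, hzero e a hea, neg_zero]
  · exact hoff e a f hea hef

end CoordinateForms

/-! ### Vanishing statements in every admissible codegree -/

section FormPairings

variable {C : Type*} [AddCommGroup C] [Module ℝ C] [FiniteDimensional ℝ C]

/-- Contraction into a volume form is injective, and `C` and its forms of codegree one both have
dimension `n + 2`. This rewrites the codegree-one problem as one about maps on `C` itself. -/
lemma exists_volume_equiv {n : ℕ} (hm : Module.finrank ℝ C = n + 2) :
    ∃ ν : C [⋀^Fin (n + 2)]→ₗ[ℝ] ℝ,
      (∀ t : Fin (n + 2) → Fin (Module.finrank ℝ C), Function.Injective t →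
        ν (fun i => Module.finBasis ℝ C (t i)) ≠ 0) ∧
      ∃ L : C ≃ₗ[ℝ] (C [⋀^Fin (n + 1)]→ₗ[ℝ] ℝ), ∀ x u, L x u = ν (Matrix.vecCons x u) := by
  set b := Module.finBasis ℝ C
  have hι : Fintype.card (Fin (Module.finrank ℝ C)) = n + 2 := by simp [hm]
  let ν := coordForm b (Fin.cast hm.symm : Fin (n + 2) → Fin (Module.finrank ℝ C))
  have hν : ∀ t : Fin (n + 2) → Fin (Module.finrank ℝ C), Function.Injective t →
      ν (fun i => b (t i)) ≠ 0 := fun t ht =>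
    volume_apply_ne_zero b hι _ (Fin.cast_injective _) t ht
  have hinj : Function.Injective ν.curryLeft := by
    rw [injective_iff_map_eq_zero]
    intro x hx
    refine b.ext_elem fun a => ?_
    obtain ⟨d, hd⟩ := exists_ne_list [a] (by simp [hm])
    obtain ⟨t, ht, h⟩ := exists_compl_pair hι (a := a) (d := d) (by simpa using Ne.symm (by simpa using hd))
    have had : a ≠ d := Ne.symm (by simpa using hd)
    have h1 : ν (Matrix.vecCons x (Matrix.vecCons (b d) fun i => b (t i))) = 0 :=
      DFunLike.congr_fun hx _
    rw [map_vecCons_vecCons_swap, volume_vecCons_vecCons b ν h, neg_eq_zero] at h1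
    simpa using (mul_eq_zero.1 h1).resolve_right (volume_basis_ne_zero b ν hν had ht h)
  have hfin : Module.finrank ℝ C = Module.finrank ℝ (C [⋀^Fin (n + 1)]→ₗ[ℝ] ℝ) := by
    rw [finrank_alternatingMap, hm, Nat.choose_succ_self_right]
  have : FiniteDimensional ℝ (C [⋀^Fin (n + 1)]→ₗ[ℝ] ℝ) :=
    Module.finite_of_finrank_pos (by omega)
  exact ⟨ν, hν, LinearMap.linearEquivOfInjective _ hinj hfin, fun x u => rfl⟩

theorem eq_zero_of_symm {n : ℕ} (hn : 1 ≤ n) (hm : n + 2 ≤ Module.finrank ℝ C)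
    (B : (C [⋀^Fin (n + 1)]→ₗ[ℝ] ℝ) →ₗ[ℝ] C)
    (hB : ∀ (α β : C [⋀^Fin (n + 1)]→ₗ[ℝ] ℝ) (u : Fin n → C),
      β (Matrix.vecCons (B α) u) = α (Matrix.vecCons (B β) u)) : B = 0 := by
  rcases hm.lt_or_eq with hm | hm
  · exact eq_zero_of_symm_of_card (Module.finBasis ℝ C) hn (by rw [Fintype.card_fin]; omega) B hB
  · obtain ⟨ν, hν, L, hL⟩ := exists_volume_equiv hm.symm
    have h0 : B ∘ₗ L.toLinearMap = 0 :=
      volume_eq_zero_of_symm (Module.finBasis ℝ C) hn (by simp [hm]) ν hν _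
        fun x y u => by
          have h := hB (L x) (L y) u
          rw [hL, hL] at h
          exact h
    ext α : 1
    simpa using LinearMap.congr_fun h0 (L.symm α)

theorem eq_zero_of_cyclic {n : ℕ} (hn : 1 ≤ n) (hm : n + 2 ≤ Module.finrank ℝ C)
    (hnm : 2 ≤ n ∨ (n = 1 ∧ 6 ≤ Module.finrank ℝ C))
    (c : (C [⋀^Fin (n + 1)]→ₗ[ℝ] ℝ) →ₗ[ℝ] (C [⋀^Fin (n + 1)]→ₗ[ℝ] ℝ) →ₗ[ℝ] C)
    (hanti : ∀ α β, c α β = -c β α)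
    (hc : ∀ (α β γ : C [⋀^Fin (n + 1)]→ₗ[ℝ] ℝ) (u : Fin n → C),
      γ (Matrix.vecCons (c α β) u) + α (Matrix.vecCons (c β γ) u) +
      β (Matrix.vecCons (c γ α) u) = 0) : c = 0 := by
  rcases hm.lt_or_eq with hm | hm
  · refine eq_zero_of_cyclic_of_card (Module.finBasis ℝ C) ?_ c hc
    simp only [Fintype.card_fin]
    omega
  · obtain ⟨ν, hν, L, hL⟩ := exists_volume_equiv hm.symm
    have h0 : c.compl₁₂ L.toLinearMap L.toLinearMap = 0 :=
      volume_eq_zero_of_cyclic (Module.finBasis ℝ C) (by omega) (by simp [hm]) ν hν _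
        (fun x y => hanti _ _)
        fun x y z u => by
          have h := hc (L x) (L y) (L z) u
          rw [hL, hL, hL] at h
          exact h
    refine LinearMap.ext fun α => LinearMap.ext fun β => ?_
    simpa using LinearMap.congr_fun₂ h0 (L.symm α) (L.symm β)

end FormPairings

/-! ### From forms on a complement to an isotropic subspace -/

section Transport

variable {V : Type*} [AddCommGroup V] [Module ℝ V]

/-- A subspace `W` behaves like the fibre of `Λᵏ T*Q → Q` for the form `η` of degree `k + 1`. -/
structure IsVertical (m : ℕ) {n : ℕ} (η : V [⋀^Fin (n + 2)]→ₗ[ℝ] ℝ) (W : Submodule ℝ V) :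
    Prop where
  finrank_eq : Module.finrank ℝ W = m.choose (n + 1)
  isotropic : ∀ v ∈ W, ∀ w ∈ W, ∀ u, η (Matrix.vecCons v (Matrix.vecCons w u)) = 0
  nondegenerate : ∀ v, (∀ u, η (Matrix.vecCons v u) = 0) → v = 0

/-- A form killed by contraction with `W` only depends on its arguments modulo `W`. -/
lemma map_congr_mod {n : ℕ} (β : V [⋀^Fin n]→ₗ[ℝ] ℝ) (W : Submodule ℝ V)
    (h : ∀ (i : Fin n) (v : Fin n → V), v i ∈ W → β v = 0) (x y : Fin n → V)
    (hxy : ∀ i, x i - y i ∈ W) : β x = β y := by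
  have key : ∀ S : Finset (Fin n), β x = β (S.piecewise y x) := by
    intro S
    induction S using Finset.induction_on with
    | empty => simp
    | insert i S hi ih =>
      rw [ih, Finset.piecewise_insert, ← sub_eq_zero]
      have h1 := β.map_update_sub (S.piecewise y x) i (x i) (y i)
      have h2 : Function.update (S.piecewise y x) i (x i) = S.piecewise y x := by
        rw [Function.update_eq_self_iff]; simp [hi]
      rw [h2] at h1
      rw [← h1]
      exact h i _ (by simpa using hxy i)
  simpa using key Finset.univ

/-- Isotropy is stated for the first two slots; a transposition brings slot `i` there at the cost of
a sign. -/
lemma IsVertical.eq_zero_of_mem {m n : ℕ} {η : V [⋀^Fin (n + 2)]→ₗ[ℝ] ℝ} {W : Submodule ℝ V}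
    (h : IsVertical m η W) {w : V} (hw : w ∈ W) (i : Fin (n + 1)) (v : Fin (n + 1) → V)
    (hv : v i ∈ W) : η (Matrix.vecCons w v) = 0 := by
  have hs : η.curryLeft w (v ∘ Equiv.swap 0 i) = Equiv.Perm.sign (Equiv.swap 0 i) •
      η.curryLeft w v := AlternatingMap.map_perm _ _ _
  have h0 : η.curryLeft w (v ∘ Equiv.swap 0 i) = 0 := by
    have := h.isotropic w hw (v i) hv (Matrix.vecTail (v ∘ Equiv.swap 0 i))
    rw [← this]
    change η _ = η _
    congr 2
    funext j
    refine Fin.cases ?_ (fun j => ?_) j <;> simp [Matrix.vecTail]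
  rw [h0] at hs
  rcases Int.units_eq_one_or (Equiv.Perm.sign (Equiv.swap 0 i)) with h1 | h1 <;>
    · rw [h1] at hs
      simpa using hs.symm

lemma IsVertical.map_congr {m n : ℕ} {η : V [⋀^Fin (n + 2)]→ₗ[ℝ] ℝ} {W : Submodule ℝ V}
    (h : IsVertical m η W) {w : V} (hw : w ∈ W) (x y : Fin (n + 1) → V)
    (hxy : ∀ i, x i - y i ∈ W) : η (Matrix.vecCons w x) = η (Matrix.vecCons w y) :=
  map_congr_mod (η.curryLeft w) W (fun i v hv => h.eq_zero_of_mem hw i v hv) x y hxy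

variable [FiniteDimensional ℝ V]

lemma finrank_of_isCompl {m r : ℕ} {W C : Submodule ℝ V}
    (hW : Module.finrank ℝ W = r) (hV : Module.finrank ℝ V = r + m) (hC : IsCompl W C) :
    Module.finrank ℝ C = m := by
  have := Submodule.finrank_add_eq_of_isCompl hC
  omega

/-- If `η(w, ·)` vanishes on `C`, it vanishes everywhere, since its arguments matter modulo `W`
only; then `w = 0`. Equality of dimensions upgrades injectivity to an isomorphism. -/
lemma IsVertical.exists_equiv {m n : ℕ} {η : V [⋀^Fin (n + 2)]→ₗ[ℝ] ℝ} {W C : Submodule ℝ V}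
    (h : IsVertical m η W) (hV : Module.finrank ℝ V = m.choose (n + 1) + m) (hC : IsCompl W C)
    (hnm : n + 1 ≤ m) :
    ∃ Θ : W ≃ₗ[ℝ] (C [⋀^Fin (n + 1)]→ₗ[ℝ] ℝ),
      ∀ w u, Θ w u = η (Matrix.vecCons (w : V) fun i => (u i : V)) := by
  let Θ : W →ₗ[ℝ] (C [⋀^Fin (n + 1)]→ₗ[ℝ] ℝ) :=
    { toFun := fun w => (η.curryLeft w).compLinearMap C.subtype
      map_add' := fun x y => by simp [AlternatingMap.add_compLinearMap]
      map_smul' := fun r x => by ext u; simp }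
  have hΘ : ∀ w u, Θ w u = η (Matrix.vecCons (w : V) fun i => (u i : V)) := fun _ _ => rfl
  have hinj : Function.Injective Θ := by
    rw [injective_iff_map_eq_zero]
    intro w hw
    refine Subtype.ext (h.nondegenerate w fun u => ?_)
    have hu : ∀ i, ∃ c : C, u i - c ∈ W := fun i => by
      obtain ⟨x, hx, y, hy, hxy⟩ := Submodule.mem_sup.1
        (hC.sup_eq_top ▸ Submodule.mem_top : u i ∈ W ⊔ C)
      exact ⟨⟨y, hy⟩, by rw [← hxy]; simpa using hx⟩
    choose c hc using hu
    rw [h.map_congr w.2 u _ hc, ← hΘ, hw]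
    rfl
  have hfin : Module.finrank ℝ W = Module.finrank ℝ (C [⋀^Fin (n + 1)]→ₗ[ℝ] ℝ) := by
    rw [finrank_alternatingMap, finrank_of_isCompl h.finrank_eq hV hC, h.finrank_eq]
  have : FiniteDimensional ℝ (C [⋀^Fin (n + 1)]→ₗ[ℝ] ℝ) :=
    Module.finite_of_finrank_pos (by rw [← hfin, h.finrank_eq]; exact Nat.choose_pos hnm)
  exact ⟨LinearMap.linearEquivOfInjective Θ hinj hfin, hΘ⟩

/-- The hypothesis sees `B x` modulo `W` only. Read through `W ≃ Λᵏ C*`, the `C`-component of `B` is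
a symmetric pairing, hence zero. The cyclic version below follows the same pattern. -/
theorem IsVertical.mem_of_symm {m n : ℕ} {η : V [⋀^Fin (n + 2)]→ₗ[ℝ] ℝ} {W : Submodule ℝ V}
    (h : IsVertical m η W) (hV : Module.finrank ℝ V = m.choose (n + 1) + m)
    (hn : 1 ≤ n) (hm : n + 2 ≤ m) (B : V →ₗ[ℝ] V)
    (hB : ∀ x ∈ W, ∀ y ∈ W, ∀ u,
      η (Matrix.vecCons y (Matrix.vecCons (B x) u)) =
        η (Matrix.vecCons x (Matrix.vecCons (B y) u))) :
    ∀ x ∈ W, B x ∈ W := by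
  obtain ⟨C, hC⟩ := W.exists_isCompl
  obtain ⟨Θ, hΘ⟩ := h.exists_equiv hV hC (by omega)
  let Q := Submodule.projectionOnto C W hC.symm
  have hQ : ∀ v, v - Q v ∈ W := fun v => by
    rw [← Submodule.ker_projectionOnto hC.symm, LinearMap.mem_ker, map_sub, sub_eq_zero]
    exact (Submodule.projectionOnto_apply_left hC.symm (Q v)).symm
  have key : ∀ w : W, ∀ v (u : Fin n → C), Θ w (Matrix.vecCons (Q v) u) =
      η (Matrix.vecCons (w : V) (Matrix.vecCons v fun i => (u i : V))) := by
    intro w v u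
    rw [hΘ]
    refine h.map_congr w.2 _ _ fun i => ?_
    refine Fin.cases ?_ (fun j => ?_) i
    · simpa using W.neg_mem (hQ v)
    · simp
  have h0 := eq_zero_of_symm (C := C) hn
    (by rw [finrank_of_isCompl h.finrank_eq hV hC]; exact hm)
    (Q ∘ₗ B ∘ₗ W.subtype ∘ₗ Θ.symm.toLinearMap) fun α β u => by
      obtain ⟨x, rfl⟩ := Θ.surjective α
      obtain ⟨y, rfl⟩ := Θ.surjective β
      simp only [LinearMap.comp_apply, LinearEquiv.coe_coe, LinearEquiv.symm_apply_apply, key]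
      exact hB x x.2 y y.2 _
  intro x hx
  have h1 := LinearMap.congr_fun h0 (Θ ⟨x, hx⟩)
  have h2 : Q (B x) = 0 := by simpa using h1
  simpa [h2] using hQ (B x)

theorem IsVertical.mem_of_cyclic {m n : ℕ} {η : V [⋀^Fin (n + 2)]→ₗ[ℝ] ℝ} {W : Submodule ℝ V}
    (h : IsVertical m η W) (hV : Module.finrank ℝ V = m.choose (n + 1) + m)
    (hn : 1 ≤ n) (hm : n + 2 ≤ m) (hnm : 2 ≤ n ∨ (n = 1 ∧ 6 ≤ m)) (c : V →ₗ[ℝ] V →ₗ[ℝ] V)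
    (hanti : ∀ x y, c x y = -c y x)
    (hc : ∀ x ∈ W, ∀ y ∈ W, ∀ z ∈ W, ∀ u,
      η (Matrix.vecCons z (Matrix.vecCons (c x y) u)) +
        η (Matrix.vecCons x (Matrix.vecCons (c y z) u)) +
        η (Matrix.vecCons y (Matrix.vecCons (c z x) u)) = 0) :
    ∀ x ∈ W, ∀ y ∈ W, c x y ∈ W := by
  obtain ⟨C, hC⟩ := W.exists_isCompl
  have hCm := finrank_of_isCompl h.finrank_eq hV hC
  obtain ⟨Θ, hΘ⟩ := h.exists_equiv hV hC (by omega)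
  let Q := Submodule.projectionOnto C W hC.symm
  have hQ : ∀ v, v - Q v ∈ W := fun v => by
    rw [← Submodule.ker_projectionOnto hC.symm, LinearMap.mem_ker, map_sub, sub_eq_zero]
    exact (Submodule.projectionOnto_apply_left hC.symm (Q v)).symm
  have key : ∀ w : W, ∀ v (u : Fin n → C), Θ w (Matrix.vecCons (Q v) u) =
      η (Matrix.vecCons (w : V) (Matrix.vecCons v fun i => (u i : V))) := by
    intro w v u
    rw [hΘ]
    refine h.map_congr w.2 _ _ fun i => ?_
    refine Fin.cases ?_ (fun j => ?_) i
    · simpa using W.neg_mem (hQ v)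
    · simp
  let j := W.subtype ∘ₗ Θ.symm.toLinearMap
  have h0 := eq_zero_of_cyclic (C := C) hn (by omega) (by omega)
    ((c.compl₁₂ j j).compr₂ Q) (fun α β => by simp [hanti (j α) (j β)]) fun α β γ u => by
      obtain ⟨x, rfl⟩ := Θ.surjective α
      obtain ⟨y, rfl⟩ := Θ.surjective β
      obtain ⟨z, rfl⟩ := Θ.surjective γ
      simp only [j, LinearMap.compr₂_apply, LinearMap.compl₁₂_apply, LinearMap.comp_apply,
        LinearEquiv.coe_coe, LinearEquiv.symm_apply_apply, key]
      exact hc x x.2 y y.2 z z.2 _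
  intro x hx y hy
  have h1 := LinearMap.congr_fun₂ h0 (Θ ⟨x, hx⟩) (Θ ⟨y, hy⟩)
  have h2 : Q (c x y) = 0 := by simpa [j] using h1
  simpa [h2] using hQ (c x y)

end Transport

/-! ### Evaluating and differentiating forms on variable vectors -/

section Insertion

variable {E : Type*} [NormedAddCommGroup E] [NormedSpace ℝ E]
  {F : Type*} [NormedAddCommGroup F] [NormedSpace ℝ F] {n : ℕ}

lemma contDiffAt_alternating_apply [FiniteDimensional ℝ E] {N : WithTop ℕ∞}
    {θ : F → E [⋀^Fin n]→L[ℝ] ℝ} {v : Fin n → F → E} {p : F} (hθ : ContDiffAt ℝ N θ p)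
    (hv : ∀ i, ContDiffAt ℝ N (v i) p) : ContDiffAt ℝ N (fun y => θ y (fun i => v i y)) p := by
  let b := Module.finBasis ℝ E
  have h : ∀ y, θ y (fun i => v i y) = ∑ s : Fin n → Fin (Module.finrank ℝ E),
      θ y (fun i => b (s i)) * ∏ i, LinearMap.toContinuousLinearMap (b.coord (s i)) (v i y) := by
    intro y
    have := congrArg (fun μ => μ fun i => v i y)
      (multilinear_eq_sum_basis b (θ y).toAlternatingMap.toMultilinearMap)
    simpa using this
  simp only [h]
  refine ContDiffAt.sum fun s _ => ContDiffAt.mul ?_ (contDiffAt_prod fun i _ => ?_)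
  · exact (ContinuousAlternatingMap.apply ℝ E ℝ _).contDiff.contDiffAt.comp p hθ
  · exact (ContinuousLinearMap.contDiff _).contDiffAt.comp p (hv i)

lemma fderiv_insert_two {θ : F → E [⋀^Fin (n + 2)]→L[ℝ] ℝ} {X Y : F → E} {p : F}
    (hθ : DifferentiableAt ℝ θ p) (hX : DifferentiableAt ℝ X p) (hY : DifferentiableAt ℝ Y p)
    (u : Fin n → E) (e : F) :
    fderiv ℝ (fun y => θ y (Matrix.vecCons (X y) (Matrix.vecCons (Y y) u))) p e =
      fderiv ℝ θ p e (Matrix.vecCons (X p) (Matrix.vecCons (Y p) u)) +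
        θ p (Matrix.vecCons (fderiv ℝ X p e) (Matrix.vecCons (Y p) u)) +
        θ p (Matrix.vecCons (X p) (Matrix.vecCons (fderiv ℝ Y p e) u)) := by
  let v : Fin (n + 2) → F → E :=
    Matrix.vecCons X (Matrix.vecCons Y fun i _ => u i)
  have hv : ∀ y, (fun i => v i y) = Matrix.vecCons (X y) (Matrix.vecCons (Y y) u) := by
    intro y
    funext i
    refine Fin.cases rfl (fun i => Fin.cases rfl (fun i => rfl) i) i
  have hd : ∀ i, DifferentiableAt ℝ (v i) p := fun i =>
    Fin.cases hX (fun i => Fin.cases hY (fun i => differentiableAt_const _) i) i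
  have h := fderiv_continuousAlternatingMap_apply_apply hθ hd e
  simp only [hv] at h
  rw [h, Fin.sum_univ_succ, Fin.sum_univ_succ]
  have h0 : ∀ i : Fin n, fderiv ℝ (v i.succ.succ) p e = 0 := fun i => by
    have : v i.succ.succ = fun _ => u i := rfl
    rw [this]; simp
  have e1 : ∀ x : E, Function.update (Matrix.vecCons (X p) (Matrix.vecCons (Y p) u)) 0 x =
      Matrix.vecCons x (Matrix.vecCons (Y p) u) := fun x => by
    exact Fin.update_cons_zero _ _ _
  have e2 : ∀ x : E, Function.update (Matrix.vecCons (X p) (Matrix.vecCons (Y p) u))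
      (Fin.succ 0) x = Matrix.vecCons (X p) (Matrix.vecCons x u) := fun x => by
    exact (Fin.cons_update _ _ _ _).symm.trans (congrArg _ (Fin.update_cons_zero _ _ _))
  rw [e1, e2, Finset.sum_eq_zero, add_zero]
  · exact (add_assoc _ _ _).symm
  · intro i _
    rw [h0]
    exact (θ p).toMultilinearMap.map_update_zero _ _

end Insertion

/-! ### Continuity of projections along a fixed complement -/

section Projections

variable {E : Type*} [NormedAddCommGroup E] [NormedSpace ℝ E]

/-- `P` is the projection onto `W` along `C`. -/
structure IsProjAlong (P : E →L[ℝ] E) (W C : Submodule ℝ E) : Prop where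
  mem : ∀ v, P v ∈ W
  map_id : ∀ w ∈ W, P w = w
  sub_mem : ∀ v, v - P v ∈ C
  map_zero : ∀ v ∈ C, P v = 0

lemma IsProjAlong.map_eq {P : E →L[ℝ] E} {W C : Submodule ℝ E} (h : IsProjAlong P W C) {v w : E}
    (hvw : v - w ∈ C) : P v = P w := by
  rw [← sub_eq_zero, ← map_sub, h.map_zero _ hvw]

variable [FiniteDimensional ℝ E]

lemma exists_isProjAlong {W C : Submodule ℝ E} (h : IsCompl W C) :
    ∃ P : E →L[ℝ] E, IsProjAlong P W C := by
  refine ⟨LinearMap.toContinuousLinearMap (W.projection C h), ?_, ?_, ?_, ?_⟩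
  · intro v; simp [← Submodule.coe_projectionOnto_apply]
  · intro w hw
    simp [← Submodule.coe_projectionOnto_apply, Submodule.projectionOnto_apply_of_mem_left h hw]
  · intro v
    refine (Submodule.projectionOnto_apply_eq_zero_iff h).1 ?_
    rw [map_sub, sub_eq_zero]
    exact (Submodule.projectionOnto_projection h v).symm
  · intro v hv
    simp [← Submodule.coe_projectionOnto_apply, Submodule.projectionOnto_apply_of_mem_right h hv]

/-- `hcl` says that limits of vectors in nearby fibres lie in the fibre at `y₀`. The unit vectors at
distance at least `ε` from their projection form a compact set missing that fibre, hence missing all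
nearby fibres; homogeneity does the rest. -/
lemma eventually_norm_sub_le {𝓦 : E → Submodule ℝ E} {y₀ : E} {C : Submodule ℝ E} {P : E →L[ℝ] E}
    (hP : IsProjAlong P (𝓦 y₀) C)
    (hcl : ∀ v ∉ 𝓦 y₀, ∀ᶠ q : E × E in 𝓝 (y₀, v), q.2 ∉ 𝓦 q.1) {ε : ℝ} (hε : 0 < ε) :
    ∀ᶠ y in 𝓝 y₀, ∀ v ∈ 𝓦 y, ‖v - P v‖ ≤ ε * ‖v‖ := by
  have hK : IsCompact (Metric.sphere (0 : E) 1 ∩ {v | ε ≤ ‖v - P v‖}) :=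
    (isCompact_sphere 0 1).inter_right (isClosed_le continuous_const (by fun_prop))
  have h1 := hK.eventually_forall_of_forall_eventually (x₀ := y₀) (P := fun y v => v ∉ 𝓦 y) (by
    rintro v ⟨-, hv⟩
    refine hcl v fun hmem => ?_
    have : ε ≤ ‖v - P v‖ := hv
    rw [hP.map_id v hmem, sub_self, norm_zero] at this
    linarith)
  filter_upwards [h1] with y hy v hv
  by_cases hv0 : v = 0
  · simp [hv0]
  by_contra! hlt
  have hn : 0 < ‖v‖ := norm_pos_iff.2 hv0
  refine hy (‖v‖⁻¹ • v) ⟨?_, ?_⟩ ((𝓦 y).smul_mem _ hv)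
  · simp [norm_smul, hn.ne']
  · change ε ≤ _
    rw [map_smul, ← smul_sub, norm_smul, norm_inv, norm_norm, le_inv_mul_iff₀ hn]
    linarith [mul_comm ε ‖v‖]

lemma eventually_isCompl {𝓦 : E → Submodule ℝ E} {y₀ : E} {C : Submodule ℝ E}
    (hC : IsCompl (𝓦 y₀) C)
    (hcl : ∀ v ∉ 𝓦 y₀, ∀ᶠ q : E × E in 𝓝 (y₀, v), q.2 ∉ 𝓦 q.1)
    (hdim : ∀ᶠ y in 𝓝 y₀, Module.finrank ℝ (𝓦 y) = Module.finrank ℝ (𝓦 y₀)) :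
    ∀ᶠ y in 𝓝 y₀, IsCompl (𝓦 y) C := by
  obtain ⟨P, hP⟩ := exists_isProjAlong hC
  filter_upwards [hdim, eventually_norm_sub_le hP hcl one_half_pos] with y hd hy
  rw [Submodule.isCompl_iff_disjoint _ _ (by rw [hd, Submodule.finrank_add_eq_of_isCompl hC]),
    Submodule.disjoint_def]
  intro v hv hvC
  have h := hy v hv
  rw [hP.map_zero v hvC, sub_zero] at h
  have := norm_nonneg v
  exact norm_eq_zero.1 (by linarith)

lemma tendsto_isProjAlong {𝓦 : E → Submodule ℝ E} {y₀ : E} {C : Submodule ℝ E}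
    {Pr : E → E →L[ℝ] E} (hcl : ∀ v ∉ 𝓦 y₀, ∀ᶠ q : E × E in 𝓝 (y₀, v), q.2 ∉ 𝓦 q.1)
    (hPr : ∀ᶠ y in 𝓝 y₀, IsProjAlong (Pr y) (𝓦 y) C) : Tendsto Pr (𝓝 y₀) (𝓝 (Pr y₀)) := by
  have hP := hPr.self_of_nhds
  rw [Metric.tendsto_nhds]
  intro ε hε
  set c := ‖Pr y₀‖ with hc
  have hc0 : 0 ≤ c := norm_nonneg _
  -- `δ ≤ 1/2` lets the error `δ ‖Pr y v‖` be absorbed, giving `‖Pr y v‖ ≤ 2c ‖v‖`; the last bound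
  -- then controls the operator norm of the difference.
  obtain ⟨δ, hδ, hδ2, hδε⟩ : ∃ δ : ℝ, 0 < δ ∧ δ ≤ 1 / 2 ∧ δ * (2 * c) < ε := by
    refine ⟨min (1 / 2) (ε / (4 * c + 1)), by positivity, min_le_left _ _, ?_⟩
    have h1 : min (1 / 2) (ε / (4 * c + 1)) * (2 * c) ≤ ε / (4 * c + 1) * (2 * c) := by
      gcongr; exact min_le_right _ _
    refine h1.trans_lt ?_
    rw [div_mul_eq_mul_div, div_lt_iff₀ (by positivity)]
    nlinarith
  filter_upwards [hPr, eventually_norm_sub_le hP hcl hδ] with y hy hle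
  rw [dist_eq_norm]
  refine lt_of_le_of_lt (ContinuousLinearMap.opNorm_le_bound _ (by positivity) fun v => ?_) hδε
  have h1 := hle (Pr y v) (hy.mem v)
  have h2 : Pr y₀ (Pr y v) = Pr y₀ v := hP.map_eq (by
    rw [← neg_sub]; exact C.neg_mem (hy.sub_mem v))
  rw [h2] at h1
  have h3 : ‖Pr y v‖ ≤ ‖Pr y₀ v‖ + ‖Pr y v - Pr y₀ v‖ := by
    have := norm_add_le (Pr y₀ v) (Pr y v - Pr y₀ v)
    simpa using this
  have h4 : ‖Pr y₀ v‖ ≤ c * ‖v‖ := (Pr y₀).le_opNorm v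
  have h5 : ‖Pr y v‖ ≤ 2 * (c * ‖v‖) := by
    have := norm_nonneg (Pr y v)
    nlinarith
  calc ‖(Pr y - Pr y₀) v‖ = ‖Pr y v - Pr y₀ v‖ := rfl
    _ ≤ δ * ‖Pr y v‖ := h1
    _ ≤ δ * (2 * (c * ‖v‖)) := by gcongr
    _ = δ * (2 * c) * ‖v‖ := by ring

end Projections

/-! ### Regularity from an overdetermined implicit equation -/

section ImplicitFunction

/-- A local solution of `G(y, Φ y) = 0` is as smooth as `G` if the partial derivative of `G` in the
second variable is injective. -/
lemma contDiffAt_of_implicit {E₁ E₂ Y : Type*} [NormedAddCommGroup E₁] [NormedSpace ℝ E₁]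
    [CompleteSpace E₁] [NormedAddCommGroup E₂] [NormedSpace ℝ E₂] [FiniteDimensional ℝ E₂]
    [NormedAddCommGroup Y] [NormedSpace ℝ Y] [FiniteDimensional ℝ Y] {N : WithTop ℕ∞} (hN : N ≠ 0)
    {G : E₁ × E₂ → Y} {Φ : E₁ → E₂} {y₀ : E₁} (hG : ContDiffAt ℝ N G (y₀, Φ y₀))
    (hΦ : ContinuousAt Φ y₀) (hsol : ∀ᶠ y in 𝓝 y₀, G (y, Φ y) = 0)
    (hinj : ∀ e : E₂, fderiv ℝ G (y₀, Φ y₀) (0, e) = 0 → e = 0) : ContDiffAt ℝ N Φ y₀ := by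
  have : CompleteSpace E₂ := FiniteDimensional.complete ℝ E₂
  set D := fderiv ℝ G (y₀, Φ y₀) ∘L .inr ℝ E₁ E₂ with hD
  have hDinj : Function.Injective D := (injective_iff_map_eq_zero D).2 fun e he => hinj e he
  -- The partial derivative is only injective. Composing `G` with a left inverse `L` makes it the
  -- identity; `Φ` still solves `L ∘ G = 0`, and continuity places it in the region where the
  -- implicit function is the unique solution.
  obtain ⟨L, hL⟩ := ContinuousLinearMap.HasLeftInverse.of_injective_of_finiteDimensional hDinj
  have hf : ContDiffAt ℝ N (L ∘ G) (y₀, Φ y₀) := L.contDiff.contDiffAt.comp _ hG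
  have hfd : fderiv ℝ (L ∘ G) (y₀, Φ y₀) ∘L .inr ℝ E₁ E₂ = .id ℝ E₂ := by
    have h := (L.hasFDerivAt.comp _ (hG.differentiableAt hN).hasFDerivAt).fderiv
    rw [h]
    ext e
    exact hL e
  have hinv : (fderiv ℝ (L ∘ G) (y₀, Φ y₀) ∘L .inr ℝ E₁ E₂).IsInvertible := by
    rw [hfd]
    exact ⟨ContinuousLinearEquiv.refl ℝ E₂, rfl⟩
  have h1 := hf.contDiffAt_implicitFunction hN hinv
  have h2 := hf.eventually_apply_eq_iff_implicitFunction hN hinv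
  have h3 : Tendsto (fun y => (y, Φ y)) (𝓝 y₀) (𝓝 (y₀, Φ y₀)) :=
    continuousAt_id.prodMk hΦ
  refine h1.congr_of_eventuallyEq ?_
  filter_upwards [h3.eventually h2, hsol] with y hy hs
  refine (hy.1 ?_).symm
  simp [hs, hsol.self_of_nhds]

end ImplicitFunction

/-! ### Smoothness and brackets in coordinates -/

section LocalTheory

variable {E : Type*} [NormedAddCommGroup E] [NormedSpace ℝ E] [FiniteDimensional ℝ E]
  {m n : ℕ} {θ : E → E [⋀^Fin (n + 2)]→L[ℝ] ℝ} {𝓦 : E → Submodule ℝ E} {C : Submodule ℝ E}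
  {Pr : E → E →L[ℝ] E} {y₀ : E}

/-- Infinitesimal rigidity: the equations satisfied by a first-order deformation of the projection
onto a vertical subspace have no nonzero solution. -/
lemma IsVertical.deformation_eq_zero {η : E [⋀^Fin (n + 2)]→L[ℝ] ℝ} {W : Submodule ℝ E}
    (h : IsVertical m η.toAlternatingMap W)
    (hdim : Module.finrank ℝ E = m.choose (n + 1) + m) (hn : 1 ≤ n) (hm : n + 2 ≤ m)
    {P B : E →L[ℝ] E} (hP : IsProjAlong P W C) (hB : ∀ v, B v - (B (P v) - P (B (P v))) = 0)
    {ι : Type*} (b : Module.Basis ι ℝ E)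
    (hηB : ∀ i j (s : Fin n → ι),
      η (Matrix.vecCons (B (b i)) (Matrix.vecCons (P (b j)) fun l => b (s l))) +
        η (Matrix.vecCons (P (b i)) (Matrix.vecCons (B (b j)) fun l => b (s l))) = 0) :
    B = 0 := by
  let S : E →ₗ[ℝ] E →ₗ[ℝ] E [⋀^Fin n]→ₗ[ℝ] ℝ :=
    AlternatingMap.curryLeftLinearMap ∘ₗ η.toAlternatingMap.curryLeft
  have hT : S.compl₁₂ B.toLinearMap P.toLinearMap + S.compl₁₂ P.toLinearMap B.toLinearMap = 0 :=
    b.ext fun i => b.ext fun j => Module.Basis.ext_alternating b fun s _ => hηB i j s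
  have hall : ∀ x y u, η (Matrix.vecCons (B x) (Matrix.vecCons (P y) u)) +
      η (Matrix.vecCons (P x) (Matrix.vecCons (B y) u)) = 0 := fun x y u =>
    DFunLike.congr_fun (LinearMap.congr_fun₂ hT x y) u
  have hmem := h.mem_of_symm hdim hn hm B.toLinearMap fun x hx y hy u => by
    have h1 := hall x y u
    rw [hP.map_id x hx, hP.map_id y hy] at h1
    have h2 := map_vecCons_vecCons_swap η.toAlternatingMap (B x) y u
    have h3 : η (Matrix.vecCons (B x) (Matrix.vecCons y u)) =
      -η (Matrix.vecCons y (Matrix.vecCons (B x) u)) := h2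
    change η (Matrix.vecCons y (Matrix.vecCons (B x) u)) =
      η (Matrix.vecCons x (Matrix.vecCons (B y) u))
    linarith
  ext v
  have h1 := hB v
  rw [hP.map_id (B (P v)) (hmem _ (hP.mem v)), sub_self, sub_zero] at h1
  simpa using h1

lemma fderiv_clm_comp_apply_eq_zero {F Y Z : Type*} [NormedAddCommGroup F] [NormedSpace ℝ F]
    [NormedAddCommGroup Y] [NormedSpace ℝ Y] [NormedAddCommGroup Z] [NormedSpace ℝ Z]
    {G : F → Y} {p e : F} (hG : DifferentiableAt ℝ G p) (he : fderiv ℝ G p e = 0)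
    (L : Y →L[ℝ] Z) : fderiv ℝ (fun q => L (G q)) p e = 0 := by
  have h1 : HasFDerivAt (fun q => L (G q)) (L ∘L fderiv ℝ G p) p :=
    L.hasFDerivAt.comp _ hG.hasFDerivAt
  rw [h1.fderiv, ContinuousLinearMap.comp_apply, he, map_zero]

/-- The projection onto the vertical subspaces along a fixed complement is smooth. -/
theorem contDiffAt_projection {N : WithTop ℕ∞} (hN : N ≠ 0)
    (hdim : Module.finrank ℝ E = m.choose (n + 1) + m) (hn : 1 ≤ n) (hm : n + 2 ≤ m)
    (hθ : ContDiffAt ℝ N θ y₀) (hv : ∀ᶠ y in 𝓝 y₀, IsVertical m (θ y).toAlternatingMap (𝓦 y))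
    (hcl : ∀ v ∉ 𝓦 y₀, ∀ᶠ q : E × E in 𝓝 (y₀, v), q.2 ∉ 𝓦 q.1)
    (hPr : ∀ᶠ y in 𝓝 y₀, IsProjAlong (Pr y) (𝓦 y) C) : ContDiffAt ℝ N Pr y₀ := by
  let b := Module.finBasis ℝ E
  have hP := hPr.self_of_nhds
  set P := Pr y₀ with hPdef
  -- The first component says `q.2 = P + (1 - P) ∘ q.2 ∘ P`, which holds for projections along the
  -- same complement as `P`; the second says that the image of `q.2` is isotropic, tested on basis
  -- vectors.
  let G : E × (E →L[ℝ] E) → (E →L[ℝ] E) × (Fin (Module.finrank ℝ E) →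
      Fin (Module.finrank ℝ E) → (Fin n → Fin (Module.finrank ℝ E)) → ℝ) := fun q =>
    (q.2 - P - (q.2 ∘L P - P ∘L q.2 ∘L P), fun i j s =>
      θ q.1 (Matrix.vecCons (q.2 (b i)) (Matrix.vecCons (q.2 (b j)) fun l => b (s l))))
  have hcomp : ∀ (i j : Fin (Module.finrank ℝ E)) (s : Fin n → Fin (Module.finrank ℝ E)),
      ContDiffAt ℝ N (fun q : E × (E →L[ℝ] E) =>
      θ q.1 (Matrix.vecCons (q.2 (b i)) (Matrix.vecCons (q.2 (b j)) fun l => b (s l))))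
      (y₀, P) := by
    intro i j s
    have hθ' : ContDiffAt ℝ N (fun q : E × (E →L[ℝ] E) => θ q.1) (y₀, P) :=
      hθ.comp (y₀, P) contDiffAt_fst
    have hX : ∀ x : E, ContDiffAt ℝ N (fun q : E × (E →L[ℝ] E) => q.2 x) (y₀, P) := fun x =>
      contDiffAt_snd.clm_apply contDiffAt_const
    let v : Fin (n + 2) → E × (E →L[ℝ] E) → E :=
      Matrix.vecCons (fun q => q.2 (b i)) (Matrix.vecCons (fun q => q.2 (b j)) fun l _ => b (s l))
    have h := contDiffAt_alternating_apply (v := v) hθ' fun l =>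
      Fin.cases (hX _) (fun l => Fin.cases (hX _) (fun l => contDiffAt_const) l) l
    refine h.congr_of_eventuallyEq (Eventually.of_forall fun q => ?_)
    change θ q.1 _ = θ q.1 _
    congr 1
    funext l
    exact Fin.cases rfl (fun l => Fin.cases rfl (fun l => rfl) l) l
  have hfirst : ContDiffAt ℝ N
      (fun q : E × (E →L[ℝ] E) => q.2 - P - (q.2 ∘L P - P ∘L q.2 ∘L P)) (y₀, P) := by
    have h2 : ContDiffAt ℝ N (fun q : E × (E →L[ℝ] E) => q.2 ∘L P) (y₀, P) :=
      contDiffAt_snd.clm_comp contDiffAt_const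
    exact (contDiffAt_snd.sub contDiffAt_const).sub (h2.sub (contDiffAt_const.clm_comp h2))
  have hG : ContDiffAt ℝ N G (y₀, P) :=
    hfirst.prodMk (contDiffAt_pi.2 fun i => contDiffAt_pi.2 fun j => contDiffAt_pi.2 fun s =>
      hcomp i j s)
  refine contDiffAt_of_implicit hN (G := G) hG (tendsto_isProjAlong hcl hPr) ?_ ?_
  · filter_upwards [hPr, hv] with y hy hvy
    refine Prod.ext ?_ ?_
    · ext v
      have h1 : Pr y (P v) = Pr y v := hy.map_eq (by
        rw [← neg_sub]; exact C.neg_mem (hP.sub_mem v))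
      have h2 : P (Pr y v) = P v := hP.map_eq (by
        rw [← neg_sub]; exact C.neg_mem (hy.sub_mem v))
      simp [G, h1, h2]
    · funext i j s
      exact hvy.isotropic _ (hy.mem _) _ (hy.mem _) _
  · intro B hB
    have hGd := (hG.differentiableAt hN).hasFDerivAt
    have hX : ∀ x : E, HasFDerivAt (fun q : E × (E →L[ℝ] E) => q.2 x)
        (ContinuousLinearMap.apply ℝ E x ∘L .snd ℝ E (E →L[ℝ] E)) (y₀, P) := fun x =>
      (ContinuousLinearMap.apply ℝ E x ∘L .snd ℝ E (E →L[ℝ] E)).hasFDerivAt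
    refine hv.self_of_nhds.deformation_eq_zero hdim hn hm hP ?_ b ?_
    · intro v
      have h1 := fderiv_clm_comp_apply_eq_zero (hG.differentiableAt hN) hB (ContinuousLinearMap.apply ℝ E v ∘L .fst ℝ _ _)
      have h2 : HasFDerivAt (fun q : E × (E →L[ℝ] E) =>
          q.2 v - P v - (q.2 (P v) - P (q.2 (P v)))) _ (y₀, P) :=
        ((hX v).sub_const (P v)).sub ((hX (P v)).sub (P.hasFDerivAt.comp _ (hX (P v))))
      have h3 := h2.fderiv
      change fderiv ℝ (fun q : E × (E →L[ℝ] E) =>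
          q.2 v - P v - (q.2 (P v) - P (q.2 (P v)))) (y₀, P) (0, B) = 0 at h1
      rw [h3] at h1
      simpa using h1
    · intro i j s
      have h1 := fderiv_clm_comp_apply_eq_zero (hG.differentiableAt hN) hB (.proj s ∘L .proj j ∘L .proj i ∘L .snd ℝ _ _)
      have hθ' : HasFDerivAt (fun q : E × (E →L[ℝ] E) => θ q.1)
          (fderiv ℝ θ y₀ ∘L .fst ℝ E (E →L[ℝ] E)) (y₀, P) :=
        (hθ.differentiableAt hN).hasFDerivAt.comp (y₀, P) hasFDerivAt_fst
      have h2 := fderiv_insert_two hθ'.differentiableAt (hX (b i)).differentiableAt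
        (hX (b j)).differentiableAt (fun l => b (s l)) (0, B)
      rw [hθ'.fderiv, (hX (b i)).fderiv, (hX (b j)).fderiv] at h2
      change fderiv ℝ (fun q : E × (E →L[ℝ] E) =>
        θ q.1 (Matrix.vecCons (q.2 (b i)) (Matrix.vecCons (q.2 (b j)) fun l => b (s l))))
        (y₀, P) (0, B) = 0 at h1
      rw [h2] at h1
      simpa using h1

/-- The bracket of two fields of vertical vectors of a closed form is vertical, expressed through
the derivative of the projection. -/
theorem bracket_projection_mem
    (hdim : Module.finrank ℝ E = m.choose (n + 1) + m) (hn : 1 ≤ n) (hm : n + 2 ≤ m)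
    (hnm : 2 ≤ n ∨ (n = 1 ∧ 6 ≤ m)) (hθ : DifferentiableAt ℝ θ y₀) (hclosed : extDeriv θ y₀ = 0)
    (hv : ∀ᶠ y in 𝓝 y₀, IsVertical m (θ y).toAlternatingMap (𝓦 y))
    (hPr : ∀ᶠ y in 𝓝 y₀, IsProjAlong (Pr y) (𝓦 y) C) (hd : DifferentiableAt ℝ Pr y₀) :
    ∀ x ∈ 𝓦 y₀, ∀ y ∈ 𝓦 y₀, fderiv ℝ Pr y₀ x y - fderiv ℝ Pr y₀ y x ∈ 𝓦 y₀ := by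
  have hP := hPr.self_of_nhds
  have hV := hv.self_of_nhds
  set D := fderiv ℝ Pr y₀ with hD
  have hX : ∀ x : E, HasFDerivAt (fun y => Pr y x) (D.flip x) y₀ := fun x => by
    have := hd.hasFDerivAt.clm_apply (hasFDerivAt_const x y₀)
    simpa using this
  -- The derivative at `y₀` of the identity `θ(Pr x, Pr y, u) = 0`, extending `x` and `y` to
  -- vertical fields through `Pr`.
  have key : ∀ x ∈ 𝓦 y₀, ∀ y ∈ 𝓦 y₀, ∀ (u : Fin n → E) e,
      fderiv ℝ θ y₀ e (Matrix.vecCons x (Matrix.vecCons y u)) +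
        θ y₀ (Matrix.vecCons (D e x) (Matrix.vecCons y u)) +
        θ y₀ (Matrix.vecCons x (Matrix.vecCons (D e y) u)) = 0 := by
    intro x hx y hy u e
    have h1 := fderiv_insert_two hθ (hX x).differentiableAt (hX y).differentiableAt u e
    have h2 : (fun z => θ z (Matrix.vecCons (Pr z x) (Matrix.vecCons (Pr z y) u))) =ᶠ[𝓝 y₀]
        fun _ => 0 := by
      filter_upwards [hPr, hv] with z hz hvz
      exact hvz.isotropic _ (hz.mem _) _ (hz.mem _) _
    rw [h2.fderiv_eq, (hX x).fderiv, (hX y).fderiv, hP.map_id x hx, hP.map_id y hy] at h1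
    simpa using h1.symm
  have sw := map_vecCons_vecCons_swap (θ y₀).toAlternatingMap
  have swap : ∀ x y u, θ y₀ (Matrix.vecCons x (Matrix.vecCons y u)) =
    -θ y₀ (Matrix.vecCons y (Matrix.vecCons x u)) := sw
  let c : E →ₗ[ℝ] E →ₗ[ℝ] E := LinearMap.mk₂ ℝ (fun x y => D x y - D y x)
    (by intros; simp; abel) (by intros; simp [smul_sub]) (by intros; simp; abel)
    (by intros; simp [smul_sub])
  refine hV.mem_of_cyclic hdim hn hm hnm c (fun x y => by simp [c]) fun x hx y hy z hz u => ?_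
  have h0 : extDeriv θ y₀ (Matrix.vecCons x (Matrix.vecCons y (Matrix.vecCons z u))) = 0 := by
    rw [hclosed]; rfl
  rw [extDeriv_apply hθ, Fin.sum_univ_succ, Fin.sum_univ_succ, Fin.sum_univ_succ,
    Finset.sum_eq_zero, add_zero] at h0
  · simp only [fderiv_continuousAlternatingMap_apply_const_apply hθ] at h0
    have e0 : Fin.removeNth 0 (Matrix.vecCons x (Matrix.vecCons y (Matrix.vecCons z u))) =
        Matrix.vecCons y (Matrix.vecCons z u) := by
      funext i; rfl
    have e1 : Fin.removeNth (Fin.succ 0)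
        (Matrix.vecCons x (Matrix.vecCons y (Matrix.vecCons z u))) =
        Matrix.vecCons x (Matrix.vecCons z u) := by
      funext i; exact Fin.cases rfl (fun i => rfl) i
    have e2 : Fin.removeNth (Fin.succ (Fin.succ 0))
        (Matrix.vecCons x (Matrix.vecCons y (Matrix.vecCons z u))) =
        Matrix.vecCons x (Matrix.vecCons y u) := by
      funext i; exact Fin.cases rfl (fun i => Fin.cases rfl (fun i => rfl) i) i
    rw [e0, e1, e2] at h0
    simp at h0
    rw [Nat.mod_eq_of_lt (by omega), neg_one_sq, one_mul] at h0
    have k0 := key y hy z hz u x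
    have k1 := key x hx z hz u y
    have k2 := key x hx y hy u z
    have lin : ∀ w a a', θ y₀ (Matrix.vecCons w (Matrix.vecCons (a - a') u)) =
        θ y₀ (Matrix.vecCons w (Matrix.vecCons a u)) -
          θ y₀ (Matrix.vecCons w (Matrix.vecCons a' u)) := fun w a a' =>
      map_sub (headMap ((θ y₀).toAlternatingMap.curryLeft w) u) a a'
    change θ y₀ _ + θ y₀ _ + θ y₀ _ = 0
    simp only [c, LinearMap.mk₂_apply, lin]
    linarith [swap (D x y) z u, swap (D y x) z u, swap (D z x) y u]
  -- The terms of `dθ` differentiating along some `u i` keep `x`, `y` and `z` as arguments. By `key`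
  -- each is a sum of values of `θ` with at least two vertical arguments, hence zero.
  · intro i _
    rw [fderiv_continuousAlternatingMap_apply_const_apply hθ]
    obtain ⟨n, rfl⟩ : ∃ l, n = l + 1 := ⟨n - 1, by omega⟩
    set w : Fin (n + 1) → E := fun l => Fin.removeNth i.succ.succ.succ
      (Matrix.vecCons x (Matrix.vecCons y (Matrix.vecCons z u))) l.succ.succ with hw
    have hr : Fin.removeNth i.succ.succ.succ
        (Matrix.vecCons x (Matrix.vecCons y (Matrix.vecCons z u))) =
        Matrix.vecCons x (Matrix.vecCons y w) := by
      funext l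
      refine Fin.cases rfl (fun l => Fin.cases rfl (fun l => rfl) l) l
    have hwz : w 0 = z := rfl
    have hz0 : ∀ a, ∀ b ∈ 𝓦 y₀, θ y₀ (Matrix.vecCons b (Matrix.vecCons a w)) = 0 :=
      fun a b hb => hV.eq_zero_of_mem hb 1 _ (by simpa [hwz] using hz)
    have k := key x hx y hy w (u i)
    rw [swap, hz0 _ y hy, hz0 _ x hx, neg_zero, add_zero, add_zero] at k
    rw [hr]
    refine (congrArg _ ?_).trans (smul_zero _)
    simpa using k

/-- Differentiating `Z = Pr Z` gives `D_e Z = Pr (D_e Z) + (D_e Pr) Z`. The first terms are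
vertical, and the second ones combine to the antisymmetrized derivative of `Pr`. -/
theorem lieBracket_mem
    (hdim : Module.finrank ℝ E = m.choose (n + 1) + m) (hn : 1 ≤ n) (hm : n + 2 ≤ m)
    (hnm : 2 ≤ n ∨ (n = 1 ∧ 6 ≤ m)) (hθ : DifferentiableAt ℝ θ y₀) (hclosed : extDeriv θ y₀ = 0)
    (hv : ∀ᶠ y in 𝓝 y₀, IsVertical m (θ y).toAlternatingMap (𝓦 y))
    (hPr : ∀ᶠ y in 𝓝 y₀, IsProjAlong (Pr y) (𝓦 y) C) (hd : DifferentiableAt ℝ Pr y₀)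
    {X Y : E → E} (hX : DifferentiableAt ℝ X y₀) (hY : DifferentiableAt ℝ Y y₀)
    (hXm : ∀ᶠ y in 𝓝 y₀, X y ∈ 𝓦 y) (hYm : ∀ᶠ y in 𝓝 y₀, Y y ∈ 𝓦 y) :
    VectorField.lieBracket ℝ X Y y₀ ∈ 𝓦 y₀ := by
  have key : ∀ {Z : E → E}, DifferentiableAt ℝ Z y₀ → (∀ᶠ y in 𝓝 y₀, Z y ∈ 𝓦 y) → ∀ e,
      fderiv ℝ Z y₀ e = Pr y₀ (fderiv ℝ Z y₀ e) + fderiv ℝ Pr y₀ e (Z y₀) := by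
    intro Z hZ hZm e
    have h1 : Z =ᶠ[𝓝 y₀] fun y => Pr y (Z y) := by
      filter_upwards [hPr, hZm] with y hy hz
      exact (hy.map_id _ hz).symm
    have h2 : fderiv ℝ Z y₀ = fderiv ℝ (fun y => Pr y (Z y)) y₀ := h1.fderiv_eq
    rw [HasFDerivAt.fderiv (hd.hasFDerivAt.clm_apply hZ.hasFDerivAt)] at h2
    have h3 := congrArg (fun L : E →L[ℝ] E => L e) h2
    simpa using h3
  have hP := hPr.self_of_nhds
  change fderiv ℝ Y y₀ (X y₀) - fderiv ℝ X y₀ (Y y₀) ∈ _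
  rw [key hX hXm, key hY hYm]
  have h1 := bracket_projection_mem hdim hn hm hnm hθ hclosed hv hPr hd _ hXm.self_of_nhds _
    hYm.self_of_nhds
  have h2 := (𝓦 y₀).add_mem ((𝓦 y₀).sub_mem (hP.mem (fderiv ℝ Y y₀ (X y₀)))
    (hP.mem (fderiv ℝ X y₀ (Y y₀)))) h1
  convert h2 using 1
  abel

end LocalTheory

/-! ### Rank conditions: invariance and a test by independent vectors -/

section LowRank

variable {V V' : Type*} [AddCommGroup V] [Module ℝ V] [AddCommGroup V'] [Module ℝ V']

lemma mem_lowRankSet_iff {n r : ℕ} {η : V [⋀^Fin (n + 2)]→ₗ[ℝ] ℝ} {v : V} :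
    v ∈ lowRankSet r η ↔
      Module.finrank ℝ (LinearMap.range (η.curryLeft v).curryLeft) ≤ r := Iff.rfl

lemma formRank_compLinearMap {n : ℕ} (β : V [⋀^Fin (n + 1)]→ₗ[ℝ] ℝ) (e : V' ≃ₗ[ℝ] V) :
    formRank (β.compLinearMap e.toLinearMap) = formRank β := by
  have h : (β.compLinearMap e.toLinearMap).curryLeft =
      (AlternatingMap.domLCongr ℝ ℝ (Fin n) ℝ e.symm).toLinearMap ∘ₗ β.curryLeft ∘ₗ
        e.toLinearMap := by
    ext x u
    change β _ = β _
    congr 1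
    funext i
    refine Fin.cases rfl (fun i => rfl) i
  change Module.finrank ℝ (LinearMap.range (β.compLinearMap e.toLinearMap).curryLeft) =
    Module.finrank ℝ (LinearMap.range β.curryLeft)
  rw [h, LinearMap.range_comp, LinearMap.range_comp_of_range_eq_top _ (LinearEquiv.range e)]
  exact LinearEquiv.finrank_map_eq _ _

lemma lowRankSet_compLinearMap {n r : ℕ} (η : V [⋀^Fin (n + 2)]→ₗ[ℝ] ℝ) (e : V' ≃ₗ[ℝ] V) :
    lowRankSet r (η.compLinearMap e.toLinearMap) = e ⁻¹' lowRankSet r η := by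
  ext v
  change formRank ((η.compLinearMap e.toLinearMap).curryLeft v) ≤ r ↔
    formRank (η.curryLeft (e v)) ≤ r
  rw [← formRank_compLinearMap (η.curryLeft (e v)) e]
  have h : (η.compLinearMap e.toLinearMap).curryLeft v =
      (η.curryLeft (e v)).compLinearMap e.toLinearMap := by
    ext u
    change η _ = η _
    congr 1
    funext i
    refine Fin.cases rfl (fun i => rfl) i
  rw [h]

lemma IsVertical.of_lowRankSet {m n : ℕ} {η : V [⋀^Fin (n + 2)]→ₗ[ℝ] ℝ} {W : Submodule ℝ V}
    (hW : (W : Set V) = lowRankSet m η) (hfin : Module.finrank ℝ W = m.choose (n + 1))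
    (hiso : ∀ v ∈ lowRankSet m η, ∀ w ∈ lowRankSet m η, contract (contract η v) w = 0)
    (hη : Nondegenerate η) : IsVertical m η W where
  finrank_eq := hfin
  isotropic v hv w hw u := by
    have hv' : v ∈ lowRankSet m η := hW ▸ hv
    have hw' : w ∈ lowRankSet m η := hW ▸ hw
    exact DFunLike.congr_fun (hiso v hv' w hw') u
  nondegenerate v hv := by
    refine hη ?_
    rw [map_zero]
    ext u
    exact hv u

lemma IsVertical.compLinearMap {m n : ℕ} {η : V [⋀^Fin (n + 2)]→ₗ[ℝ] ℝ} {W : Submodule ℝ V}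
    (h : IsVertical m η W) (e : V' ≃ₗ[ℝ] V) :
    IsVertical m (η.compLinearMap e.toLinearMap) (W.comap e.toLinearMap) where
  finrank_eq := by
    rw [Submodule.comap_equiv_eq_map_symm, ← h.finrank_eq]
    exact LinearEquiv.finrank_map_eq e.symm W
  isotropic v hv w hw u := by
    rw [← h.isotropic (e v) hv (e w) hw (fun i => e (u i))]
    change η _ = η _
    congr 1
    funext i
    refine Fin.cases rfl (fun i => Fin.cases rfl (fun i => rfl) i) i
  nondegenerate v hv := by
    have : e v = 0 := h.nondegenerate _ fun u => by
      rw [← hv (fun i => e.symm (u i))]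
      change η _ = η _
      congr 1
      funext i
      refine Fin.cases rfl (fun i => (e.apply_symm_apply (u i)).symm) i
    simpa using this

/-- Evaluation of a form at all tuples of basis vectors. -/
def evalBasis {ι : Type*} (b : Module.Basis ι ℝ V) (n : ℕ) :
    (V [⋀^Fin n]→ₗ[ℝ] ℝ) →ₗ[ℝ] ((Fin n → ι) → ℝ) where
  toFun β s := β fun i => b (s i)
  map_add' _ _ := rfl
  map_smul' _ _ := rfl

lemma evalBasis_injective {ι : Type*} (b : Module.Basis ι ℝ V) (n : ℕ) :
    Function.Injective (evalBasis b n) := fun α β h =>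
  Module.Basis.ext_alternating b fun s _ => congrFun h s

/-- Large rank is witnessed by finitely many independent values. Independence of a finite family is
an open condition, which is what semicontinuity needs; `ev` moves the values to a space of functions
where continuity is checked entrywise. -/
lemma lt_finrank_range_iff {N K : Type*} [AddCommGroup N] [Module ℝ N] [AddCommGroup K]
    [Module ℝ K] [FiniteDimensional ℝ V] (T : V →ₗ[ℝ] N) (ev : N →ₗ[ℝ] K)
    (hev : Function.Injective ev) (r : ℕ) :
    r < Module.finrank ℝ (LinearMap.range T) ↔
      ∃ f : Fin (r + 1) → V, LinearIndependent ℝ fun i => ev (T (f i)) := by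
  constructor
  · intro h
    obtain ⟨g, hg⟩ := exists_linearIndependent_of_le_finrank (R := ℝ) (Nat.succ_le_of_lt h)
    have hg2 : ∀ i, ∃ x, T x = g i := fun i => (g i).2
    choose f hf using hg2
    refine ⟨f, ?_⟩
    simp only [hf]
    exact (hg.map' (LinearMap.range T).subtype (Submodule.ker_subtype _)).map' ev
      (LinearMap.ker_eq_bot.2 hev)
  · rintro ⟨f, hf⟩
    have h1 : LinearIndependent ℝ fun i => T (f i) := LinearIndependent.of_comp ev hf
    have h2 : LinearIndependent ℝ fun i => T.rangeRestrict (f i) :=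
      LinearIndependent.of_comp (LinearMap.range T).subtype h1
    have h3 := h2.fintype_card_le_finrank
    rw [Fintype.card_fin] at h3
    omega

lemma notMem_lowRankSet_iff [FiniteDimensional ℝ V] {ι : Type*}
    (b : Module.Basis ι ℝ V) {n r : ℕ} {η : V [⋀^Fin (n + 2)]→ₗ[ℝ] ℝ} {v : V} :
    v ∉ lowRankSet r η ↔ ∃ f : Fin (r + 1) → V,
      LinearIndependent ℝ fun i (s : Fin n → ι) =>
        η (Matrix.vecCons v (Matrix.vecCons (f i) fun l => b (s l))) := by
  rw [mem_lowRankSet_iff, not_le]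
  exact lt_finrank_range_iff _ (evalBasis b n) (evalBasis_injective b n) r

end LowRank

/-! ### Semicontinuity of the rank -/

section LocalTheory

variable {E : Type*} [NormedAddCommGroup E] [NormedSpace ℝ E] [FiniteDimensional ℝ E]

/-- The rank is lower semicontinuous. -/
lemma eventually_notMem_lowRankSet {n r : ℕ} {θ : E → E [⋀^Fin (n + 2)]→L[ℝ] ℝ} {y₀ v : E}
    (hθ : ContDiffAt ℝ 0 θ y₀) (hv : v ∉ lowRankSet r (θ y₀).toAlternatingMap) :
    ∀ᶠ q : E × E in 𝓝 (y₀, v), q.2 ∉ lowRankSet r (θ q.1).toAlternatingMap := by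
  let b := Module.finBasis ℝ E
  obtain ⟨f, hf⟩ := (notMem_lowRankSet_iff b).1 hv
  have hc : ∀ (i : Fin (r + 1)) (s : Fin n → Fin (Module.finrank ℝ E)), ContinuousAt (fun q : E × E =>
      θ q.1 (Matrix.vecCons q.2 (Matrix.vecCons (f i) fun l => b (s l)))) (y₀, v) := by
    intro i s
    have hθ' : ContDiffAt ℝ 0 (fun q : E × E => θ q.1) (y₀, v) :=
      hθ.comp (y₀, v) contDiffAt_fst
    let w : Fin (n + 2) → E × E → E :=
      Matrix.vecCons (fun q => q.2) (Matrix.vecCons (fun _ => f i) fun l _ => b (s l))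
    have h := (contDiffAt_alternating_apply (v := w) hθ' fun l =>
      Fin.cases contDiffAt_snd (fun l => Fin.cases contDiffAt_const
        (fun l => contDiffAt_const) l) l).continuousAt
    refine h.congr (Eventually.of_forall fun q => ?_)
    change θ q.1 _ = θ q.1 _
    congr 1
    funext l
    exact Fin.cases rfl (fun l => Fin.cases rfl (fun l => rfl) l) l
  have hc' : ContinuousAt (fun (q : E × E) i (s : Fin n → Fin (Module.finrank ℝ E)) =>
      θ q.1 (Matrix.vecCons q.2 (Matrix.vecCons (f i) fun l => b (s l)))) (y₀, v) :=
    continuousAt_pi.2 fun i => continuousAt_pi.2 fun s => hc i s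
  filter_upwards [hc'.eventually hf.eventually] with q hq
  exact (notMem_lowRankSet_iff b).2 ⟨f, hq⟩

end LocalTheory

/-! ### Passage between the manifold and its charts -/

section Charts

variable {E : Type*} [NormedAddCommGroup E] [NormedSpace ℝ E]
  {M : Type*} [TopologicalSpace M] [ChartedSpace E M] [IsManifold 𝓘(ℝ, E) ∞ M]

/-- The coordinate expression of a field of subspaces of the tangent spaces. -/
def chartSubmodule (W : ∀ p : M, Submodule ℝ (TangentSpace 𝓘(ℝ, E) p)) (x₀ : M) (y : E) :
    Submodule ℝ E :=
  (W ((extChartAt 𝓘(ℝ, E) x₀).symm y)).comap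
    (mfderiv 𝓘(ℝ, E) 𝓘(ℝ, E) (extChartAt 𝓘(ℝ, E) x₀).symm y).toLinearMap

lemma isInvertible_mfderiv_symm {x₀ : M} {y : E} (hy : y ∈ (extChartAt 𝓘(ℝ, E) x₀).target) :
    (mfderiv 𝓘(ℝ, E) 𝓘(ℝ, E) (extChartAt 𝓘(ℝ, E) x₀).symm y).IsInvertible := by
  have : IsManifold 𝓘(ℝ, E) 1 M := .of_le (n := ∞) (by simp)
  have h := isInvertible_mfderivWithin_extChartAt_symm hy
  rwa [ModelWithCorners.range_eq_univ, mfderivWithin_univ] at h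

lemma mfderiv_inverse_apply {x₀ : M} {y : E} (hy : y ∈ (extChartAt 𝓘(ℝ, E) x₀).target) (v : E) :
    (mfderiv 𝓘(ℝ, E) 𝓘(ℝ, E) (extChartAt 𝓘(ℝ, E) x₀)
      ((extChartAt 𝓘(ℝ, E) x₀).symm y)).inverse v =
      mfderiv 𝓘(ℝ, E) 𝓘(ℝ, E) (extChartAt 𝓘(ℝ, E) x₀).symm y v := by
  have : IsManifold 𝓘(ℝ, E) 1 M := .of_le (n := ∞) (by simp)
  have h1 := mfderiv_extChartAt_comp_mfderivWithin_extChartAt_symm (I := 𝓘(ℝ, E)) hy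
  rw [ModelWithCorners.range_eq_univ, mfderivWithin_univ] at h1
  have h2 := isInvertible_mfderiv_extChartAt (I := 𝓘(ℝ, E)) ((extChartAt 𝓘(ℝ, E) x₀).map_target hy)
  refine (h2.inverse_apply_eq).2 ?_
  exact (DFunLike.congr_fun h1 v).symm

/-- In a chart, vectors of the base correspond linearly to tangent vectors. -/
lemma exists_tangent_equiv (W : ∀ p : M, Submodule ℝ (TangentSpace 𝓘(ℝ, E) p)) {x₀ q : M}
    (hq : q ∈ (extChartAt 𝓘(ℝ, E) x₀).source) :
    ∃ e : E ≃ₗ[ℝ] TangentSpace 𝓘(ℝ, E) q,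
      (∀ v : E, (mfderiv 𝓘(ℝ, E) 𝓘(ℝ, E) (extChartAt 𝓘(ℝ, E) x₀) q).inverse v = e v) ∧
      ∀ v : E, e v ∈ W q ↔ v ∈ chartSubmodule W x₀ (extChartAt 𝓘(ℝ, E) x₀ q) := by
  obtain ⟨y, hy, rfl⟩ : ∃ y ∈ (extChartAt 𝓘(ℝ, E) x₀).target, (extChartAt 𝓘(ℝ, E) x₀).symm y = q :=
    ⟨_, (extChartAt 𝓘(ℝ, E) x₀).map_source hq, (extChartAt 𝓘(ℝ, E) x₀).left_inv hq⟩
  obtain ⟨e, he⟩ := isInvertible_mfderiv_symm hy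
  refine ⟨e.toLinearEquiv, fun v => ?_, fun v => ?_⟩
  · exact (mfderiv_inverse_apply hy v).trans (by rw [← he]; rfl)
  · rw [(extChartAt 𝓘(ℝ, E) x₀).right_inv hy, chartSubmodule, ← he]; rfl

lemma isVertical_chart {m n : ℕ} {Ω : ∀ x : M, TangentSpace 𝓘(ℝ, E) x [⋀^Fin (n + 2)]→L[ℝ] ℝ}
    {W : ∀ p : M, Submodule ℝ (TangentSpace 𝓘(ℝ, E) p)}
    (hv : ∀ p, IsVertical m (formAt Ω p) (W p)) {x₀ : M} {y : E}
    (hy : y ∈ (extChartAt 𝓘(ℝ, E) x₀).target) :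
    IsVertical m (formInChart Ω x₀ y).toAlternatingMap (chartSubmodule W x₀ y) := by
  obtain ⟨e, he⟩ := isInvertible_mfderiv_symm hy
  have h := (hv ((extChartAt 𝓘(ℝ, E) x₀).symm y)).compLinearMap e.toLinearEquiv
  have h1 : (formInChart Ω x₀ y).toAlternatingMap =
      (formAt Ω ((extChartAt 𝓘(ℝ, E) x₀).symm y)).compLinearMap e.toLinearEquiv.toLinearMap := by
    rw [formInChart, ← he]; rfl
  rw [h1, chartSubmodule, ← he]
  exact h

lemma coe_chartSubmodule {m n : ℕ} {Ω : ∀ x : M, TangentSpace 𝓘(ℝ, E) x [⋀^Fin (n + 2)]→L[ℝ] ℝ}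
    {W : ∀ p : M, Submodule ℝ (TangentSpace 𝓘(ℝ, E) p)}
    (hW : ∀ p, (W p : Set (TangentSpace 𝓘(ℝ, E) p)) = lowRankSet m (formAt Ω p)) {x₀ : M} {y : E}
    (hy : y ∈ (extChartAt 𝓘(ℝ, E) x₀).target) :
    (chartSubmodule W x₀ y : Set E) = lowRankSet m (formInChart Ω x₀ y).toAlternatingMap := by
  obtain ⟨e, he⟩ := isInvertible_mfderiv_symm hy
  have h := lowRankSet_compLinearMap (r := m) (formAt Ω ((extChartAt 𝓘(ℝ, E) x₀).symm y))
    e.toLinearEquiv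
  have h1 : (formInChart Ω x₀ y).toAlternatingMap =
      (formAt Ω ((extChartAt 𝓘(ℝ, E) x₀).symm y)).compLinearMap e.toLinearEquiv.toLinearMap := by
    rw [formInChart, ← he]; rfl
  rw [h1, chartSubmodule, ← he]
  refine Eq.trans ?_ h.symm
  rw [← hW]
  rfl

variable [FiniteDimensional ℝ E]

lemma contDiffAt_formInChart {j : ℕ} {Ω : ∀ x : M, TangentSpace 𝓘(ℝ, E) x [⋀^Fin j]→L[ℝ] ℝ}
    (hΩ : IsSmoothForm Ω) {x₀ : M} {y : E} (hy : y ∈ (extChartAt 𝓘(ℝ, E) x₀).target) :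
    ContDiffAt ℝ ∞ (formInChart Ω x₀) y :=
  (hΩ x₀).contDiffAt ((isOpen_extChartAt_target x₀).mem_nhds hy)

lemma eventually_notMem_chartSubmodule {m n : ℕ}
    {Ω : ∀ x : M, TangentSpace 𝓘(ℝ, E) x [⋀^Fin (n + 2)]→L[ℝ] ℝ} (hΩ : IsSmoothForm Ω)
    {W : ∀ p : M, Submodule ℝ (TangentSpace 𝓘(ℝ, E) p)}
    (hW : ∀ p, (W p : Set (TangentSpace 𝓘(ℝ, E) p)) = lowRankSet m (formAt Ω p)) {x₀ : M} {y : E}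
    (hy : y ∈ (extChartAt 𝓘(ℝ, E) x₀).target) :
    ∀ v ∉ chartSubmodule W x₀ y, ∀ᶠ q : E × E in 𝓝 (y, v), q.2 ∉ chartSubmodule W x₀ q.1 := by
  intro v hv
  rw [← SetLike.mem_coe, coe_chartSubmodule hW hy] at hv
  have h1 : ∀ᶠ q : E × E in 𝓝 (y, v), q.1 ∈ (extChartAt 𝓘(ℝ, E) x₀).target :=
    continuousAt_fst.eventually ((isOpen_extChartAt_target x₀).mem_nhds hy)
  filter_upwards [h1, eventually_notMem_lowRankSet
    ((contDiffAt_formInChart hΩ hy).of_le (by simp)) hv] with q hq1 hq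
  rwa [← SetLike.mem_coe, coe_chartSubmodule hW hq1]

/-- Near every point of a chart there are a complement of the vertical subspaces and smooth
projections along it. -/
lemma exists_smooth_projection {m n : ℕ}
    (hdim : Module.finrank ℝ E = m.choose (n + 1) + m) (hn : 1 ≤ n) (hm : n + 2 ≤ m)
    {Ω : ∀ x : M, TangentSpace 𝓘(ℝ, E) x [⋀^Fin (n + 2)]→L[ℝ] ℝ} (hΩ : IsSmoothForm Ω)
    {W : ∀ p : M, Submodule ℝ (TangentSpace 𝓘(ℝ, E) p)}
    (hW : ∀ p, (W p : Set (TangentSpace 𝓘(ℝ, E) p)) = lowRankSet m (formAt Ω p))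
    (hv : ∀ p, IsVertical m (formAt Ω p) (W p)) {x₀ : M} {y₀ : E}
    (hy₀ : y₀ ∈ (extChartAt 𝓘(ℝ, E) x₀).target) :
    ∃ (C : Submodule ℝ E) (Pr : E → E →L[ℝ] E) (N : Set E), IsOpen N ∧ y₀ ∈ N ∧
      N ⊆ (extChartAt 𝓘(ℝ, E) x₀).target ∧
      ∀ y ∈ N, IsProjAlong (Pr y) (chartSubmodule W x₀ y) C ∧ ContDiffAt ℝ ∞ Pr y := by
  obtain ⟨C, hC⟩ := (chartSubmodule W x₀ y₀).exists_isCompl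
  -- `Pr` must be defined for all `y`; where `C` fails to be a complement it takes an arbitrary
  -- value, here `0`. Such points stay outside `N`.
  have hex : ∀ y, ∃ P : E →L[ℝ] E, IsCompl (chartSubmodule W x₀ y) C →
      IsProjAlong P (chartSubmodule W x₀ y) C := fun y => by
    by_cases h : IsCompl (chartSubmodule W x₀ y) C
    · exact (exists_isProjAlong h).imp fun P hP _ => hP
    · exact ⟨0, fun h' => absurd h' h⟩
  choose Pr hPr using hex
  have htarget := (isOpen_extChartAt_target (I := 𝓘(ℝ, E)) x₀).mem_nhds hy₀
  have h1 := eventually_isCompl hC (eventually_notMem_chartSubmodule hΩ hW hy₀) (by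
    filter_upwards [htarget] with y hy
    rw [(isVertical_chart hv hy).finrank_eq, (isVertical_chart hv hy₀).finrank_eq])
  obtain ⟨N, hN, hNo, hyN⟩ := eventually_nhds_iff.1 (h1.and htarget)
  refine ⟨C, Pr, N, hNo, hyN, fun y hy => (hN y hy).2, fun y hy => ⟨hPr y (hN y hy).1, ?_⟩⟩
  have hy' := (hN y hy).2
  refine contDiffAt_projection (by simp) hdim hn hm (contDiffAt_formInChart hΩ hy') ?_
    (eventually_notMem_chartSubmodule hΩ hW hy') (C := C) ?_
  · filter_upwards [hNo.mem_nhds hy] with z hz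
    exact isVertical_chart hv (hN z hz).2
  · filter_upwards [hNo.mem_nhds hy] with z hz
    exact hPr z (hN z hz).1

theorem isDistribution_of_isVertical {m n : ℕ}
    (hdim : Module.finrank ℝ E = m.choose (n + 1) + m) (hn : 1 ≤ n) (hm : n + 2 ≤ m)
    {Ω : ∀ x : M, TangentSpace 𝓘(ℝ, E) x [⋀^Fin (n + 2)]→L[ℝ] ℝ} (hΩ : IsSmoothForm Ω)
    {W : ∀ p : M, Submodule ℝ (TangentSpace 𝓘(ℝ, E) p)}
    (hW : ∀ p, (W p : Set (TangentSpace 𝓘(ℝ, E) p)) = lowRankSet m (formAt Ω p))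
    (hv : ∀ p, IsVertical m (formAt Ω p) (W p)) :
    IsDistribution (m.choose (n + 1)) (fun p : M => lowRankSet m (formAt Ω p)) := by
  have : CompleteSpace E := FiniteDimensional.complete ℝ E
  intro p
  set φ := extChartAt 𝓘(ℝ, E) p with hφ
  have hp : φ p ∈ φ.target := mem_extChartAt_target p
  obtain ⟨C, Pr, N, hNo, hpN, hNt, hN⟩ := exists_smooth_projection hdim hn hm hΩ hW hv hp
  let w := Module.finBasisOfFinrankEq ℝ (chartSubmodule W p (φ p)) (isVertical_chart hv hp).finrank_eq
  -- The local frame projects a fixed basis of the fibre at `φ p` onto the nearby fibres. A vector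
  -- of the central fibre killed by `Pr y` lies in `C`, so is zero; thus the frame stays
  -- independent, and it spans by dimension.
  let V : Fin (m.choose (n + 1)) → ∀ y : E, TangentSpace 𝓘(ℝ, E) y := fun i y => Pr y (w i : E)
  refine ⟨φ.source ∩ φ ⁻¹' N, isOpen_extChartAt_preimage' p hNo,
    ⟨mem_extChartAt_source p, hpN⟩, fun i => VectorField.mpullback 𝓘(ℝ, E) 𝓘(ℝ, E) φ (V i), ?_, ?_⟩
  · intro i x hx
    refine ContMDiffAt.contMDiffWithinAt ?_
    refine ContMDiffAt.mpullback_vectorField_preimage (n := ∞) ?_ ?_ ?_ (by simp)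
    · refine contMDiffAt_vectorSpace_iff_contDiffAt.2 ?_
      exact ((hN _ hx.2).2).clm_apply contDiffAt_const
    · exact contMDiffAt_extChartAt' (by simpa [hφ] using hx.1)
    · have : IsManifold 𝓘(ℝ, E) 1 M := .of_le (n := ∞) (by simp)
      exact isInvertible_mfderiv_extChartAt hx.1
  · intro q hq
    obtain ⟨e, he, heW⟩ := exists_tangent_equiv W hq.1
    have hX : (fun i => VectorField.mpullback 𝓘(ℝ, E) 𝓘(ℝ, E) φ (V i) q) =
        fun i => e (Pr (φ q) (w i : E)) := by
      funext i
      exact he _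
    have hproj := (hN _ hq.2).1
    have hproj0 := (hN _ hpN).1
    have hli : LinearIndependent ℝ fun i => Pr (φ q) (w i : E) := by
      have h1 := w.linearIndependent.map' ((Pr (φ q)).toLinearMap ∘ₗ
        (chartSubmodule W p (φ p)).subtype) (by
          rw [LinearMap.ker_eq_bot']
          intro v hv0
          have h2 : (v : E) ∈ C := by
            have h3 := hproj.sub_mem (v : E)
            have h4 : Pr (φ q) (v : E) = 0 := hv0
            rwa [h4, sub_zero] at h3
          have h5 := hproj0.map_zero _ h2
          rw [hproj0.map_id _ v.2] at h5
          exact Subtype.ext h5)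
      exact h1
    have hspan : Submodule.span ℝ (Set.range fun i => Pr (φ q) (w i : E)) =
        chartSubmodule W p (φ q) := by
      refine Submodule.eq_of_le_of_finrank_eq ?_ ?_
      · rw [Submodule.span_le]
        rintro _ ⟨i, rfl⟩
        exact hproj.mem _
      · rw [finrank_span_eq_card hli, (isVertical_chart hv (hNt hq.2)).finrank_eq, Fintype.card_fin]
    rw [hX]
    refine ⟨hli.map' e.toLinearMap (LinearEquiv.ker e), ?_⟩
    change lowRankSet m (formAt Ω q) = _
    rw [← hW q]
    refine congrArg _ ?_
    have h6 : Set.range (fun i => e (Pr (φ q) (w i : E))) =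
        e.toLinearMap '' Set.range (fun i => Pr (φ q) (w i : E)) := by
      rw [← Set.range_comp]; rfl
    rw [h6, Submodule.span_image, hspan]
    ext v
    obtain ⟨u, rfl⟩ := e.surjective v
    rw [heW u]
    exact ⟨fun h => ⟨u, h, rfl⟩, fun ⟨_, h, hu⟩ => e.injective hu ▸ h⟩

theorem isInvolutive_of_isVertical {m n : ℕ}
    (hdim : Module.finrank ℝ E = m.choose (n + 1) + m) (hn : 1 ≤ n) (hm : n + 2 ≤ m)
    (hnm : 2 ≤ n ∨ (n = 1 ∧ 6 ≤ m))
    {Ω : ∀ x : M, TangentSpace 𝓘(ℝ, E) x [⋀^Fin (n + 2)]→L[ℝ] ℝ} (hΩ : IsSmoothForm Ω)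
    (hcl : IsClosedForm Ω) {W : ∀ p : M, Submodule ℝ (TangentSpace 𝓘(ℝ, E) p)}
    (hW : ∀ p, (W p : Set (TangentSpace 𝓘(ℝ, E) p)) = lowRankSet m (formAt Ω p))
    (hv : ∀ p, IsVertical m (formAt Ω p) (W p)) :
    IsInvolutive (fun p : M => lowRankSet m (formAt Ω p)) := by
  have : CompleteSpace E := FiniteDimensional.complete ℝ E
  intro U hU X Y hX hY hXm hYm q hq
  set φ := extChartAt 𝓘(ℝ, E) q with hφ
  have hp : φ q ∈ φ.target := mem_extChartAt_target q
  obtain ⟨C, Pr, N, hNo, hpN, hNt, hN⟩ := exists_smooth_projection hdim hn hm hΩ hW hv hp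
  have hsmooth : ∀ {Z : ∀ x : M, TangentSpace 𝓘(ℝ, E) x}, IsSmoothVectorFieldOn Z U →
      DifferentiableAt ℝ (fun y : E => (VectorField.mpullbackWithin 𝓘(ℝ, E) 𝓘(ℝ, E) φ.symm Z
        (Set.range 𝓘(ℝ, E)) y : E)) (φ q) := by
    intro Z hZ
    have h1 := VectorField.contMDiffWithinAt_mpullbackWithin_extChartAt_symm (n := ∞)
      (contMDiffWithinAt_univ.2 (hZ.contMDiffAt (hU.mem_nhds hq))) uniqueMDiffOn_univ
      (Set.mem_univ q) (by simp)
    have h2 := contMDiffWithinAt_vectorSpace_iff_contDiffWithinAt.1 h1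
    refine (h2.contDiffAt ?_).differentiableAt (by simp)
    rw [Set.preimage_univ, Set.inter_univ]
    exact (isOpen_extChartAt_target q).mem_nhds hp
  have hmem : ∀ {Z : ∀ x : M, TangentSpace 𝓘(ℝ, E) x},
      (∀ x ∈ U, Z x ∈ lowRankSet m (formAt Ω x)) →
      ∀ᶠ y in 𝓝 (φ q), (VectorField.mpullbackWithin 𝓘(ℝ, E) 𝓘(ℝ, E) φ.symm Z
        (Set.range 𝓘(ℝ, E)) y : E) ∈ chartSubmodule W q y := by
    intro Z hZ
    have hU' : ∀ᶠ y in 𝓝 (φ q), φ.symm y ∈ U :=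
      (continuousAt_extChartAt_symm q).eventually (by
        rw [extChartAt_to_inv]; exact hU.mem_nhds hq)
    filter_upwards [hU', (isOpen_extChartAt_target q).mem_nhds hp] with y hy hyt
    have h1 := hZ _ hy
    rw [← hW] at h1
    obtain ⟨e, he⟩ := isInvertible_mfderiv_symm hyt
    change (mfderiv 𝓘(ℝ, E) 𝓘(ℝ, E) φ.symm y) ((mfderivWithin 𝓘(ℝ, E) 𝓘(ℝ, E) φ.symm
      (Set.range 𝓘(ℝ, E)) y).inverse (Z (φ.symm y))) ∈ W (φ.symm y)
    rw [ModelWithCorners.range_eq_univ, mfderivWithin_univ, ← he,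
      ContinuousLinearMap.inverse_equiv]
    exact (congrArg (· ∈ W (φ.symm y)) (e.apply_symm_apply _)).mpr h1
  have hbr := lieBracket_mem hdim hn hm hnm
    ((contDiffAt_formInChart hΩ hp).differentiableAt (by simp)) (hcl q _ hp)
    (by filter_upwards [hNo.mem_nhds hpN] with z hz using isVertical_chart hv (hNt hz))
    (by filter_upwards [hNo.mem_nhds hpN] with z hz using (hN z hz).1)
    ((hN _ hpN).2.differentiableAt (by simp)) (hsmooth hX) (hsmooth hY) (hmem hXm) (hmem hYm)
  obtain ⟨e, he, heW⟩ := exists_tangent_equiv W (mem_extChartAt_source (I := 𝓘(ℝ, E)) q)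
  rw [← heW, ← he] at hbr
  change _ ∈ lowRankSet m (formAt Ω q)
  rw [← hW q]
  let X' : E → E := VectorField.mpullbackWithin 𝓘(ℝ, E) 𝓘(ℝ, E) φ.symm X (Set.range 𝓘(ℝ, E))
  let Y' : E → E := VectorField.mpullbackWithin 𝓘(ℝ, E) 𝓘(ℝ, E) φ.symm Y (Set.range 𝓘(ℝ, E))
  have h4 : φ.symm ⁻¹' Set.univ ∩ Set.range 𝓘(ℝ, E) = Set.univ := by simp
  have h5 : VectorField.lieBracketWithin ℝ X' Y' (φ.symm ⁻¹' Set.univ ∩ Set.range 𝓘(ℝ, E)) (φ q) =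
      VectorField.lieBracket ℝ X' Y' (φ q) := by
    rw [h4, VectorField.lieBracketWithin_univ]
  -- The manifold bracket is by definition the pullback of the bracket of coordinate expressions in
  -- the preferred chart at `q`, the chart chosen above.
  have h6 : VectorField.mlieBracket 𝓘(ℝ, E) X Y q =
      (mfderiv 𝓘(ℝ, E) 𝓘(ℝ, E) φ q).inverse
        (VectorField.lieBracketWithin ℝ X' Y' (φ.symm ⁻¹' Set.univ ∩ Set.range 𝓘(ℝ, E)) (φ q) : E) :=
    rfl
  rw [h6, h5]
  exact hbr

end Charts

end Multisymplectic

end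

theorem mainTheorem2
    (m k : ℕ) (hk : 1 < k) (hkm : k < m) (hmk : 2 < k ∨ (k = 2 ∧ 6 ≤ m))
    {E : Type*} [NormedAddCommGroup E] [NormedSpace ℝ E] [FiniteDimensional ℝ E]
    (hdim : Module.finrank ℝ E = m.choose k + m)
    {M : Type*} [TopologicalSpace M] [ChartedSpace E M] [IsManifold 𝓘(ℝ, E) ∞ M]
    (Ω : ∀ x : M, TangentSpace 𝓘(ℝ, E) x [⋀^Fin (k + 1)]→L[ℝ] ℝ)
    (hΩ : Multisymplectic.IsMultisymplectic Ω)
    (hI : ∀ p : M, ∃ W : Submodule ℝ (TangentSpace 𝓘(ℝ, E) p),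
      (W : Set (TangentSpace 𝓘(ℝ, E) p)) =
        Multisymplectic.lowRankSet m (Multisymplectic.formAt Ω p) ∧
      Module.finrank ℝ W = m.choose k)
    (hiso : ∀ p : M, ∀ v ∈ Multisymplectic.lowRankSet m (Multisymplectic.formAt Ω p),
      ∀ w ∈ Multisymplectic.lowRankSet m (Multisymplectic.formAt Ω p),
        Multisymplectic.contract (Multisymplectic.contract (Multisymplectic.formAt Ω p) v) w = 0) :
    Multisymplectic.IsDistribution (m.choose k)
      (fun p : M => Multisymplectic.lowRankSet m (Multisymplectic.formAt Ω p)) ∧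
    Multisymplectic.IsInvolutive
      (fun p : M => Multisymplectic.lowRankSet m (Multisymplectic.formAt Ω p)) := by
  -- The form now has degree `n + 2`, so both contractions reduce definitionally to `curryLeft`.
  obtain ⟨n, rfl⟩ : ∃ n, k = n + 1 := ⟨k - 1, by omega⟩
  choose W hW hfin using hI
  have hv : ∀ p, Multisymplectic.IsVertical m (Multisymplectic.formAt Ω p) (W p) := fun p =>
    .of_lowRankSet (hW p) (hfin p) (hiso p) (hΩ.nondegenerate p)
  exact ⟨Multisymplectic.isDistribution_of_isVertical hdim (by omega) (by omega) hΩ.smooth hW hv,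
    Multisymplectic.isInvolutive_of_isVertical hdim (by omega) (by omega) (by omega) hΩ.smooth
      hΩ.closed hW hv⟩
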